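/- Let $d\ge 2$. Local spaces on an element. An element $K\subset\mathbb R^d$ is a compact polygon ($d=2$) or polyhedron ($d=3$; polytopal set in general), with connected interior and flat faces $F$, of diameter $h_K$. On $K$ we consider finite-dimensional spaces: $V(K)$, consisting of vector fields in $H(\mathrm{div},K)$ with normal trace in $L^2(\partial K)$; $W(K)$, consisting of polynomials; and the trace space $M(\partial K)=\{\mu\in L^2(\partial K):\mu|_F\in M(F)\text{ for every face }F\text{ of }K\}$. We say that $V(K)\times W(K)$ admits an $M(\partial K)$-decomposition if $\mathrm{tr}(v,w):=(v\cdot n+w)|_{\partial K}$ maps $V(K)\times W(K)$ into $M(\partial K)$ and there are subspaces $\widetilde V\subset V(K)$, $\widetilde W\subset W(K)$ with $\nabla W(K)\subset\widetilde V$, $\nabla\cdot V(K)\subset\widetilde W$, such that $\mathrm{tr}:\widetilde V^\perp\times\widetilde W^\perp\to M(\partial K)$ is an isomorphism, where $\perp$ denotes the $L^2(K)$-orthogonal complement in $V(K)$, respectively $W(K)$. A stabilization subspace is a subspace $M_S(\partial K)\subset M(\partial K)$ with $\dim M_S(\partial K)=\dim W(K)-\dim\nabla\cdot V(K)$ such that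 $\|P_{M_S}(\cdot)\|_{\partial K}$ is a norm on $\widetilde W^\perp$, where $P_{M_S}$ is the $L^2(\partial K)$-projection onto $M_S(\partial K)$. The local spaces are called admissible if $V(K)\times W(K)$ admits an $M(\partial K)$-decomposition and $M_S(\partial K)$ is a stabilization subspace for it. Mesh and global spaces. Let $\mathcal T_h$ be a conforming mesh with finitely many elements $K$, each carrying admissible local spaces, where $M(F)$ depends only on the face $F$; put $h=\max_K h_K$. Let $\mathcal G_h$ be the matrix-valued functions all of whose rows are in $V(K)$ on each $K$, $W_h$ the vector-valued functions all of whose components are in $W(K)$ on each $K$, and $M_h$ the vector-valued $L^2$ functions on the union of the faces all of whose components are in $M(F)$ on each face $F$. Write $(\cdot,\cdot)$ and $\langle\cdot,\cdot\rangle$ for the sums over $K$ of the $L^2(K)$ and $L^2(\partial K)$ inner products. With $\overline{\hat z}$ the average of $\hat z$ on $\partial K$, set $$|||(z,\hat z)|||_{1}^2=\sum_{j=1}^d\sum_K\big(\|\nabla z_j\|_K^2+h_K^{-1}\|z_j-\hat z_j\|_{\partial K}^2\big),\qquad |||(z,\hat z)|||_{PF}^2=\sum_{j=1}^d\sum_K\big(\|z_j-\overline{\hat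 z_j}\|_K^2+h_K\|\hat z_j-\overline{\hat z_j}\|_{\partial K}^2\big).$$ Theorem. Suppose that $(r_h,z_h,\hat z_h)\in\mathcal G_h\times W_h\times M_h$ satisfies $$(r_h,G)-(z_h,\nabla\cdot G)+\langle\hat z_h,Gn\rangle=0\qquad\text{for all }G\in\mathcal G_h .$$ Then $$|||(z_h,\hat z_h)|||_1^2\le C\,\Theta_h,\qquad h^{-2}\,|||(z_h,\hat z_h)|||_{PF}^2\le C\,\Theta_h,\qquad \Theta_h:=\sum_K\big(\|r_h\|_K^2+h_K^{-1}\|P_{M_S}(z_h-\hat z_h)\|_{\partial K}^2\big),$$ where $P_{M_S}$ acts componentwise. Moreover, for every $\nu>0$, $\Theta_h=\nu^{-1}\mathsf E(r_h,z_h,\hat z_h)$, where the viscous energy is $$\mathsf E(L,u,\hat u)=\nu(L,L)+\nu(u,\nabla\cdot L)-\langle\hat u,\nu Ln\rangle+(\nu L,\nabla u)+\langle-\nu Ln+\tfrac{\nu}{h_K}P_{M_S}(u-\hat u),\,u-\hat u\rangle .$$ The constant $C$ depends only on the local finite element spaces and on the shape-regularity of the elements, in the following sense. There is a function $C(\widehat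 R,\sigma)$ of (admissible) local spaces $\widehat R$ and of a number $\sigma$ such that, if every element $K$ of the mesh contains a ball of radius $\rho_K$ with $h_K\le\sigma\rho_K$, and the local spaces of $K$ are the image of admissible local spaces $\widehat R_K$ on a reference element $\widehat K$ under an affine bijection $A(\hat x)=B\hat x+b$, then the inequalities hold with any $C\ge\max_K C(\widehat R_K,\sigma)$. Here image means: $K=A(\widehat K)$, with the faces mapped to the faces, $V(K)=\{B\hat v\circ A^{-1}\}$, $W(K)=\{\hat w\circ A^{-1}\}$, $M(A\widehat F)=\{\hat\mu\circ A^{-1}\}$, and $M_S(\partial K)$ consists of the densities of the push-forwards under $A$ of the surface densities in $M_S(\partial\widehat K)$ (on each flat face, the composition with $A^{-1}$ up to a constant factor). An element may always serve as its own reference element. -/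

import Mathlib

open MeasureTheory
open scoped ContDiff RealInnerProductSpace

namespace HDG

noncomputable section

/-- The Euclidean space `ℝ^d`. -/
abbrev E (d : ℕ) : Type := EuclideanSpace ℝ (Fin d)

/-- Surface measure: the `(d-1)`-dimensional Hausdorff measure of `ℝ^d`, normalised so that it is
the `(d-1)`-dimensional Lebesgue measure on hyperplanes. -/
def surf (d : ℕ) : Measure (E d) := μHE[d - 1]

/-- Lebesgue measure on `K`. -/
abbrev vol {d : ℕ} (K : Set (E d)) : Measure (E d) := volume.restrict K

/-- Surface measure on `∂K`. -/
abbrev bdry {d : ℕ} (K : Set (E d)) : Measure (E d) := (surf d).restrict (frontier K)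

/-- The class in `L²(μ)` of a function. It is only used for square integrable functions
(smooth functions on bounded sets, restrictions of `L²` functions to subsets, and their
differences), so that the default value plays no role. -/
def toL2 {α G : Type*} [MeasurableSpace α] [NormedAddCommGroup G] (μ : Measure α) (f : α → G) :
    Lp G 2 μ :=
  open scoped Classical in if h : MemLp f 2 μ then h.toLp f else 0

/-! ### Polyhedral elements -/

/-- A (not necessarily convex or connected) compact polyhedral set: a finite union of convex hulls
of finite sets. -/
def IsPolyhedral {d : ℕ} (A : Set (E d)) : Prop :=
  ∃ S : Finset (Finset (E d)), A = ⋃ s ∈ S, convexHull ℝ (s : Set (E d))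

/-- `K` is a polygonal (`d = 2`), polyhedral (`d = 3`) element with the given set of faces: each
face is a flat polyhedral set of positive surface measure, the faces cover `∂K`, and distinct
faces overlap in a set of surface measure zero only. -/
structure IsElement {d : ℕ} (K : Set (E d)) (faces : Set (Set (E d))) : Prop where
  polyhedral : IsPolyhedral K
  connected : IsConnected (interior K)
  closure_interior : closure (interior K) = K
  finite_faces : faces.Finite
  sUnion_faces : ⋃₀ faces = frontier K
  face_polyhedral : ∀ F ∈ faces, IsPolyhedral F
  face_flat : ∀ F ∈ faces, ∃ n : E d, n ≠ 0 ∧ ∃ c : ℝ, ∀ x ∈ F, ⟪n, x⟫ = c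
  face_pos : ∀ F ∈ faces, surf d F ≠ 0
  face_inter : ∀ F ∈ faces, ∀ F' ∈ faces, F ≠ F' → surf d (F ∩ F') = 0

/-! ### Vector fields with divergence and normal trace in `L²` -/

/-- Triples consisting of a vector field on `K`, a function on `K`, and a function on `∂K`. -/
abbrev Triple {d : ℕ} (K : Set (E d)) : Type :=
  Lp (E d) 2 (vol K) × Lp ℝ 2 (vol K) × Lp ℝ 2 (bdry K)

/-- The space of the vector fields `v ∈ H(div, K)` whose normal trace `v · n` is in `L²(∂K)`.
A field is recorded together with its weak divergence and its normal trace, as the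
triple `(v, ∇·v, v · n)`. These are characterised by Green's formula
`(v, ∇φ)_K + (∇·v, φ)_K = ⟨v · n, φ⟩_{∂K}` for all smooth `φ`, which for `φ` vanishing near `∂K` is
the definition of the weak divergence and for general `φ` that of the (outward) normal trace. -/
def HdivL2 {d : ℕ} (K : Set (E d)) : Submodule ℝ (Triple K) where
  carrier := {v | ∀ φ : E d → ℝ, ContDiff ℝ ∞ φ →
    ⟪v.1, toL2 (vol K) (gradient φ)⟫ + ⟪v.2.1, toL2 (vol K) φ⟫ = ⟪v.2.2, toL2 (bdry K) φ⟫}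
  add_mem' := by
    intro a b ha hb φ hφ
    have h1 := ha φ hφ
    have h2 := hb φ hφ
    simp only [Prod.fst_add, Prod.snd_add, inner_add_left]
    linarith
  zero_mem' := by
    intro φ _
    simp
  smul_mem' := by
    intro c a ha φ hφ
    have h1 := ha φ hφ
    simp only [Prod.smul_fst, Prod.smul_snd, real_inner_smul_left]
    rw [← h1]
    ring

/-- The field itself, as an element of `L²(K)^d`. -/
abbrev field {d : ℕ} {K : Set (E d)} (v : Triple K) : Lp (E d) 2 (vol K) := v.1

/-- The divergence `∇·v ∈ L²(K)`. -/
abbrev dv {d : ℕ} {K : Set (E d)} (v : Triple K) : Lp ℝ 2 (vol K) := v.2.1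

/-- The normal trace `v · n ∈ L²(∂K)`. -/
abbrev ntr {d : ℕ} {K : Set (E d)} (v : Triple K) : Lp ℝ 2 (bdry K) := v.2.2

/-! ### Polynomials -/

/-- The function on `ℝ^d` given by a polynomial. -/
def fn {d : ℕ} (w : MvPolynomial (Fin d) ℝ) : E d → ℝ := fun x => MvPolynomial.eval (fun i => x i) w

/-- The restriction `w|_K ∈ L²(K)`. -/
def res {d : ℕ} (K : Set (E d)) (w : MvPolynomial (Fin d) ℝ) : Lp ℝ 2 (vol K) := toL2 (vol K) (fn w)

/-- The gradient `∇w|_K ∈ L²(K)^d`. -/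
def grad {d : ℕ} (K : Set (E d)) (w : MvPolynomial (Fin d) ℝ) : Lp (E d) 2 (vol K) :=
  toL2 (vol K) (gradient (fn w))

/-- The trace `w|_{∂K} ∈ L²(∂K)`. -/
def tr {d : ℕ} (K : Set (E d)) (w : MvPolynomial (Fin d) ℝ) : Lp ℝ 2 (bdry K) :=
  toL2 (bdry K) (fn w)

/-! ### Local spaces -/

/-- An element `K` with its faces and finite dimensional local spaces: the space `V(K)` of vector
fields (a subspace of `HdivL2 K`), the polynomial space `W(K)`, the spaces `M(F) ⊆ L²(F)` on the
faces `F`, and the space `M_S(∂K) ⊆ L²(∂K)`. -/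
structure LocalSpaces (d : ℕ) where
  K : Set (E d)
  faces : Set (Set (E d))
  isElement : IsElement K faces
  V : Submodule ℝ (Triple K)
  V_le : V ≤ HdivL2 K
  finV : FiniteDimensional ℝ V
  W : Submodule ℝ (MvPolynomial (Fin d) ℝ)
  finW : FiniteDimensional ℝ W
  MF : (F : Set (E d)) → Submodule ℝ (Lp ℝ 2 ((surf d).restrict F))
  MS : Submodule ℝ (Lp ℝ 2 (bdry K))
  finMS : FiniteDimensional ℝ MS

instance {d : ℕ} (S : LocalSpaces d) : FiniteDimensional ℝ S.MS := S.finMS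

namespace LocalSpaces

variable {d : ℕ}

/-- The diameter `h_K`. -/
def h (S : LocalSpaces d) : ℝ := Metric.diam S.K

/-- The space `M(∂K)` of the functions in `L²(∂K)` whose restriction to each face `F` of `K` is
in `M(F)`. -/
def M (S : LocalSpaces d) : Set (Lp ℝ 2 (bdry S.K)) :=
  {μ | ∀ F ∈ S.faces, toL2 ((surf d).restrict F) μ ∈ S.MF F}

/-- The `L²(∂K)`-orthogonal projection onto `M_S(∂K)`. -/
def PMS (S : LocalSpaces d) (μ : Lp ℝ 2 (bdry S.K)) : Lp ℝ 2 (bdry S.K) := S.MS.starProjection μ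

/-- The `L²(K)`-orthogonal complement in `V(K)` of a subspace `V'`. -/
def Vperp (S : LocalSpaces d) (V' : Submodule ℝ (Triple S.K)) : Set (Triple S.K) :=
  {v | v ∈ S.V ∧ ∀ v' ∈ V', ⟪field v, field v'⟫ = 0}

/-- The `L²(K)`-orthogonal complement in `W(K)` of a subspace `W'`. -/
def Wperp (S : LocalSpaces d) (W' : Submodule ℝ (MvPolynomial (Fin d) ℝ)) :
    Set (MvPolynomial (Fin d) ℝ) :=
  {w | w ∈ S.W ∧ ∀ w' ∈ W', ⟪res S.K w, res S.K w'⟫ = 0}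

/-- The space `∇·V(K)`. -/
def divV (S : LocalSpaces d) : Submodule ℝ (Lp ℝ 2 (vol S.K)) :=
  S.V.map (LinearMap.fst ℝ _ _ ∘ₗ LinearMap.snd ℝ _ _)

/-- The subspaces `V'` of `V(K)` and `W'` of `W(K)` provide an `M(∂K)`-decomposition of
`V(K) × W(K)`. -/
structure IsMDecomposition (S : LocalSpaces d) (V' : Submodule ℝ (Triple S.K))
    (W' : Submodule ℝ (MvPolynomial (Fin d) ℝ)) : Prop where
  V'_le : V' ≤ S.V
  W'_le : W' ≤ S.W
  /-- The combined trace `(v, w) ↦ v · n + w` maps `V(K) × W(K)` into `M(∂K)`. -/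
  trace_mem : ∀ v ∈ S.V, ∀ w ∈ S.W, ntr v + tr S.K w ∈ S.M
  grad_mem : ∀ w ∈ S.W, ∃ v ∈ V', field v = grad S.K w
  div_mem : ∀ v ∈ S.V, ∃ w ∈ W', res S.K w = dv v
  /-- The combined trace is an isomorphism from the product of the orthogonal complements
  onto `M(∂K)`. -/
  trace_bij : ∀ μ ∈ S.M, ∃! p : Triple S.K × MvPolynomial (Fin d) ℝ,
    p.1 ∈ S.Vperp V' ∧ p.2 ∈ S.Wperp W' ∧ ntr p.1 + tr S.K p.2 = μ

/-- `V(K) × W(K)` admits an `M(∂K)`-decomposition, and `M_S(∂K)` is a stabilization subspace: a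
subspace of `M(∂K)` with `dim M_S(∂K) = dim W(K) - dim ∇·V(K)` for which `‖P_{M_S} ·‖_{∂K}` is a
norm on the orthogonal complement of the `W`-component of the decomposition. -/
def IsAdmissible (S : LocalSpaces d) : Prop :=
  ∃ (V' : Submodule ℝ (Triple S.K)) (W' : Submodule ℝ (MvPolynomial (Fin d) ℝ)),
    S.IsMDecomposition V' W' ∧
    (∀ μ ∈ S.MS, μ ∈ S.M) ∧
    Module.finrank ℝ S.MS + Module.finrank ℝ S.divV = Module.finrank ℝ S.W ∧
    ∀ w ∈ S.Wperp W', ‖S.PMS (tr S.K w)‖ = 0 → w = 0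

/-- `S` is the image of `R` under the affine bijection `A x = B x + b`, that is, `A` maps the
element and the faces of `R` to those of `S`, and
`V_S = {B v ∘ A⁻¹}` (contravariant Piola transformation), `W_S = {w ∘ A⁻¹}`,
`M_S(A F) = {μ ∘ A⁻¹ : μ ∈ M_R(F)}`, while the functions `m` in the stabilization space are
transported as surface densities, i.e. `m dσ` is pushed forward by `A` (on each flat face this is
the composition with `A⁻¹` up to a constant factor). -/
structure IsAffineImage (R S : LocalSpaces d) (A : E d ≃ᵃ[ℝ] E d) : Prop where
  K_eq : S.K = A '' R.K
  faces_eq : S.faces = (fun F => A '' F) '' R.faces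
  V_to : ∀ v ∈ S.V, ∃ u ∈ R.V, ∀ᵐ x ∂(vol R.K), field v (A x) = A.linear (field u x)
  V_of : ∀ u ∈ R.V, ∃ v ∈ S.V, ∀ᵐ x ∂(vol R.K), field v (A x) = A.linear (field u x)
  W_to : ∀ w ∈ S.W, ∃ q ∈ R.W, ∀ x, fn w (A x) = fn q x
  W_of : ∀ q ∈ R.W, ∃ w ∈ S.W, ∀ x, fn w (A x) = fn q x
  M_to : ∀ F ∈ R.faces, ∀ μ ∈ S.MF (A '' F), ∃ m ∈ R.MF F,
    ∀ᵐ x ∂((surf d).restrict F), μ (A x) = m x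
  M_of : ∀ F ∈ R.faces, ∀ m ∈ R.MF F, ∃ μ ∈ S.MF (A '' F),
    ∀ᵐ x ∂((surf d).restrict F), μ (A x) = m x
  MS_to : ∀ μ ∈ S.MS, ∃ m ∈ R.MS, ∀ φ : E d → ℝ, ContDiff ℝ ∞ φ →
    ⟪μ, toL2 (bdry S.K) φ⟫ = ⟪m, toL2 (bdry R.K) (φ ∘ A)⟫
  MS_of : ∀ m ∈ R.MS, ∃ μ ∈ S.MS, ∀ φ : E d → ℝ, ContDiff ℝ ∞ φ →
    ⟪μ, toL2 (bdry S.K) φ⟫ = ⟪m, toL2 (bdry R.K) (φ ∘ A)⟫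

/-- The square of the seminorm `|(u, û)|_{1,K}`. -/
def semiOneSq (S : LocalSpaces d) (u : MvPolynomial (Fin d) ℝ) (uh : E d → ℝ) : ℝ :=
  ‖grad S.K u‖ ^ 2 + S.h⁻¹ * ‖tr S.K u - toL2 (bdry S.K) uh‖ ^ 2

/-- The square of the seminorm `|(u, û)|_{PF,K}`, in which `m` is the average of `û` on `∂K`. -/
def semiPFSq (S : LocalSpaces d) (u : MvPolynomial (Fin d) ℝ) (uh : E d → ℝ) : ℝ :=
  let m : ℝ := ⨍ x, uh x ∂(bdry S.K)
  ‖toL2 (vol S.K) (fun x => fn u x - m)‖ ^ 2 +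
    S.h * ‖toL2 (bdry S.K) (fun x => uh x - m)‖ ^ 2

end LocalSpaces

/-! ### Meshes -/

/-- A conforming mesh with `N` polygonal / polyhedral elements, each carrying local spaces, in which
the trace space on a face does not depend on the element to which the face belongs. -/
structure Mesh (d N : ℕ) where
  elem : Fin N → LocalSpaces d
  disjoint_interior : ∀ i j, i ≠ j → Disjoint (interior (elem i).K) (interior (elem j).K)
  conforming : ∀ i, ∀ F ∈ (elem i).faces,
    F ⊆ frontier (⋃ k, (elem k).K) ∨ ∃ j, j ≠ i ∧ F ∈ (elem j).faces
  MF_eq : ∀ i j, ∀ F, F ∈ (elem i).faces → F ∈ (elem j).faces → (elem i).MF F = (elem j).MF F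

namespace Mesh

variable {d N : ℕ}

/-- The union of the faces of the mesh. -/
def skeleton (T : Mesh d N) : Set (E d) := ⋃ i, frontier (T.elem i).K

/-- The mesh size `h`, the maximum of the diameters `h_K`. -/
def h (T : Mesh d N) : ℝ := ⨆ i, (T.elem i).h

/-- Shape-regularity with constant `σ`: each element `K` contains a ball of radius `ρ`
with `h_K ≤ σ ρ`. -/
def ShapeRegular (T : Mesh d N) (σ : ℝ) : Prop :=
  ∀ i, ∃ (x : E d) (ρ : ℝ), 0 < ρ ∧ Metric.ball x ρ ⊆ (T.elem i).K ∧ (T.elem i).h ≤ σ * ρ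

/-- Matrix valued functions on the mesh, the rows of which have a divergence and a normal trace on
each element: `G i j` is the `j`-th row on the `i`-th element. -/
abbrev MatFn (T : Mesh d N) : Type := (i : Fin N) → Fin d → Triple (T.elem i).K

/-- Vector valued piecewise polynomial functions: `v i j` is the `j`-th component on the `i`-th
element. -/
abbrev VecFn (_T : Mesh d N) : Type := Fin N → Fin d → MvPolynomial (Fin d) ℝ

/-- Vector valued `L²` functions on the skeleton. -/
abbrev TraceFn (T : Mesh d N) : Type := Fin d → Lp ℝ 2 ((surf d).restrict T.skeleton)

/-- The space `𝒢_h`: each row of `G|_K` is in `V(K)`. -/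
def GSpace (T : Mesh d N) : Set T.MatFn := {G | ∀ i j, G i j ∈ (T.elem i).V}

/-- The space `W_h` of vector valued functions: each component of `v|_K` is in `W(K)`. -/
def WSpace (T : Mesh d N) : Set T.VecFn := {v | ∀ i j, v i j ∈ (T.elem i).W}

/-- The space `M_h` of vector valued functions: each component of `v̂|_F` is in `M(F)`. -/
def MSpace (T : Mesh d N) : Set T.TraceFn :=
  {vh | ∀ j i, ∀ F ∈ (T.elem i).faces, toL2 ((surf d).restrict F) (vh j) ∈ (T.elem i).MF F}

/-- The restriction to the boundary of the `i`-th element of the `j`-th component of `v̂`. -/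
def onBdry (T : Mesh d N) (vh : T.TraceFn) (i : Fin N) (j : Fin d) :
    Lp ℝ 2 (bdry (T.elem i).K) :=
  toL2 (bdry (T.elem i).K) (vh j)

/-- The jump `v - v̂` on the boundary of the `i`-th element, `j`-th component. -/
def jump (T : Mesh d N) (v : T.VecFn) (vh : T.TraceFn) (i : Fin N) (j : Fin d) :
    Lp ℝ 2 (bdry (T.elem i).K) :=
  tr (T.elem i).K (v i j) - T.onBdry vh i j

/-- The square of the global discrete `H¹` norm. -/
def normOneSq (T : Mesh d N) (v : T.VecFn) (vh : T.TraceFn) : ℝ :=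
  ∑ j, ∑ i, (T.elem i).semiOneSq (v i j) (vh j)

/-- The square of the global discrete Poincaré-Friedrichs seminorm. -/
def normPFSq (T : Mesh d N) (v : T.VecFn) (vh : T.TraceFn) : ℝ :=
  ∑ j, ∑ i, (T.elem i).semiPFSq (v i j) (vh j)

/-- The discrete gradient equation
`(r, G) - (z, ∇·G) + ⟨ẑ, G n⟩ = 0` for all `G ∈ 𝒢_h`. -/
def DiscreteGradientEq (T : Mesh d N) (r : T.MatFn) (z : T.VecFn) (zh : T.TraceFn) : Prop :=
  ∀ G ∈ T.GSpace,
    (∑ i, ∑ j, ⟪field (r i j), field (G i j)⟫) - (∑ i, ∑ j, ⟪res (T.elem i).K (z i j), dv (G i j)⟫) +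
      (∑ i, ∑ j, ⟪T.onBdry zh i j, ntr (G i j)⟫) = 0

/-- `Θ_h`, the sum over the elements of `‖r‖_K² + h_K⁻¹ ‖P_{M_S} (z - ẑ)‖_{∂K}²`. -/
def theta (T : Mesh d N) (r : T.MatFn) (z : T.VecFn) (zh : T.TraceFn) : ℝ :=
  ∑ i, ((∑ j, ‖field (r i j)‖ ^ 2) +
    (T.elem i).h⁻¹ * ∑ j, ‖(T.elem i).PMS (T.jump z zh i j)‖ ^ 2)

/-- The viscous stabilization `α_v(μ) = (ν / h_K) P_{M_S} μ`. -/
def alphaV (T : Mesh d N) (ν : ℝ) (i : Fin N) (μ : Lp ℝ 2 (bdry (T.elem i).K)) :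
    Lp ℝ 2 (bdry (T.elem i).K) :=
  (ν / (T.elem i).h) • (T.elem i).PMS μ

/-- The bilinear form of the discrete Stokes operator for vanishing pressures,
`ν (L, G) + ν (u, ∇·G) - ⟨û, ν G n⟩ + (ν L, ∇v) + ⟨-ν L n + α_v(u - û), v - v̂⟩`. -/
def stokesForm (T : Mesh d N) (ν : ℝ) (L : T.MatFn) (u : T.VecFn) (uh : T.TraceFn)
    (G : T.MatFn) (v : T.VecFn) (vh : T.TraceFn) : ℝ :=
  ∑ i, ∑ j, (ν * ⟪field (L i j), field (G i j)⟫ + ν * ⟪res (T.elem i).K (u i j), dv (G i j)⟫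
    - ⟪T.onBdry uh i j, ν • ntr (G i j)⟫
    + ⟪ν • field (L i j), grad (T.elem i).K (v i j)⟫
    + ⟪-(ν • ntr (L i j)) + T.alphaV ν i (T.jump u uh i j), T.jump v vh i j⟫)

/-- The viscous energy `E(L, u, û)`. The pressure does not contribute to it. -/
def viscousEnergy (T : Mesh d N) (ν : ℝ) (L : T.MatFn) (u : T.VecFn) (uh : T.TraceFn) : ℝ :=
  T.stokesForm ν L u uh L u uh

end Mesh

end

end HDG

namespace HDG

/-! ### Classes of square integrable functions -/

section toL2

variable {α G : Type*} [MeasurableSpace α] [NormedAddCommGroup G] {μ : Measure α} {f g : α → G}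

/-! The equation decouples into one scalar problem per element and row, since `GSpace` imposes no
continuity between elements. Green's formula turns it into `(r, G) + (∇z, G) = ⟨z - ẑ, G·n⟩` for all
`G ∈ V(K)`.

On one element the `M`-decomposition splits the jump `η = z - ẑ` as `v·n + w` with `v ⊥ V'`, `w ⊥
W'`. The two parts are `L²(∂K)`-orthogonal, by Green's formula and the inclusions `∇W ⊆ V'`, `∇·V ⊆
W'` (`inner_ntr_tr`). Testing with `G = v` removes `∇z ∈ V'` and gives `‖v·n‖² = (r, v)`. The
remaining part `w` is controlled by `P_{M_S} w = P_{M_S}(η - v·n)`, and testing with the field `∇z`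
then bounds `∇z`. The constants come from comparing seminorms on finite dimensional spaces
(`exists_norm_le_of_ker_le`); this gives `exists_stability`, with no control on how the constant
depends on `K`.

Uniformity comes from moving the problem to the reference element. Under the Piola transformation
all terms of the equation are multiplied by the same Jacobian (`pull_equation`), and transporting
`M_S` by densities makes its transport the adjoint of the pull-back, so that projections compare
(`norm_starProjection_pull_sq_le`). All norms are compared through Lipschitz constants of `A` and
`A⁻¹`, which shape-regularity bounds by multiples of `h_K` and `h_K⁻¹`; the powers of `h_K` then
match (`scaled_estimates`).

The Poincaré-Friedrichs bound follows from a Poincaré inequality on the reference element, the jump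
bound, and the fact that the average is the best constant. The energy identity is Green's formula
for `r` and `z`. -/

lemma toL2_of_memLp (h : MemLp f 2 μ) : toL2 μ f = h.toLp f := by
  simp only [toL2]; exact dif_pos h

lemma coeFn_toL2 (h : MemLp f 2 μ) : toL2 μ f =ᵐ[μ] f := by
  rw [toL2_of_memLp h]; exact h.coeFn_toLp

lemma toL2_coeFn (f : Lp G 2 μ) : toL2 μ f = f := by
  rw [toL2_of_memLp (Lp.memLp f), Lp.toLp_coeFn]

/-- No integrability is needed: functions that agree almost everywhere are both square integrable or
both sent to the default value. -/
lemma toL2_congr (h : f =ᵐ[μ] g) : toL2 μ f = toL2 μ g := by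
  by_cases hf : MemLp f 2 μ
  · rw [toL2_of_memLp hf, toL2_of_memLp ((memLp_congr_ae h).1 hf)]
    exact (MemLp.toLp_eq_toLp_iff _ _).2 h
  · have hg : ¬ MemLp g 2 μ := fun hg => hf ((memLp_congr_ae h).2 hg)
    simp only [toL2]
    rw [dif_neg hf, dif_neg hg]

lemma toL2_add (hf : MemLp f 2 μ) (hg : MemLp g 2 μ) :
    toL2 μ (fun x => f x + g x) = toL2 μ f + toL2 μ g := by
  rw [toL2_of_memLp hf, toL2_of_memLp hg, ← MemLp.toLp_add]
  exact toL2_of_memLp (hf.add hg)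

lemma toL2_sub (hf : MemLp f 2 μ) (hg : MemLp g 2 μ) :
    toL2 μ (fun x => f x - g x) = toL2 μ f - toL2 μ g := by
  rw [toL2_of_memLp hf, toL2_of_memLp hg, ← MemLp.toLp_sub]
  exact toL2_of_memLp (hf.sub hg)

lemma toL2_smul [NormedSpace ℝ G] (c : ℝ) (hf : MemLp f 2 μ) :
    toL2 μ (fun x => c • f x) = c • toL2 μ f := by
  rw [toL2_of_memLp hf, ← MemLp.toLp_const_smul]
  exact toL2_of_memLp (hf.const_smul c)

lemma toL2_eq_zero (h : f =ᵐ[μ] 0) : toL2 μ f = 0 := by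
  rw [toL2_congr h, toL2_of_memLp (f := (0 : α → G)) MemLp.zero]; exact MemLp.toLp_zero _

lemma integrable_norm_sq (hf : MemLp f 2 μ) : Integrable (fun x => ‖f x‖ ^ 2) μ :=
  hf.integrable_norm_pow (by norm_num)

variable [InnerProductSpace ℝ G]

lemma inner_eq_integral (f g : Lp G 2 μ) : ⟪f, g⟫ = ∫ x, ⟪f x, g x⟫ ∂μ := rfl

lemma inner_toL2_right (f : Lp G 2 μ) {g : α → G} (hg : MemLp g 2 μ) :
    ⟪f, toL2 μ g⟫ = ∫ x, ⟪f x, g x⟫ ∂μ := by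
  rw [inner_eq_integral]
  refine integral_congr_ae ?_
  filter_upwards [coeFn_toL2 hg] with x hx
  rw [hx]

lemma norm_toL2_sq (hf : MemLp f 2 μ) : ‖toL2 μ f‖ ^ 2 = ∫ x, ‖f x‖ ^ 2 ∂μ := by
  rw [← real_inner_self_eq_norm_sq, inner_eq_integral]
  refine integral_congr_ae ?_
  filter_upwards [coeFn_toL2 hf] with x hx
  rw [hx, real_inner_self_eq_norm_sq]

end toL2

/-! ### Smooth functions -/

section smooth

variable {d : ℕ}

lemma contDiff_fn (w : MvPolynomial (Fin d) ℝ) : ContDiff ℝ ∞ (fn w) := by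
  unfold fn
  induction w using MvPolynomial.induction_on with
  | C a => simpa using contDiff_const
  | add p q hp hq => simpa using hp.add hq
  | mul_X p i hp =>
    simp only [map_mul, MvPolynomial.eval_X]
    exact hp.mul (by fun_prop)

lemma continuous_gradient {φ : E d → ℝ} (hφ : ContDiff ℝ ∞ φ) : Continuous (gradient φ) := by
  have : gradient φ = fun x => (InnerProductSpace.toDual ℝ (E d)).symm (fderiv ℝ φ x) := rfl
  rw [this]
  exact (LinearIsometryEquiv.continuous _).comp (hφ.continuous_fderiv (by simp))

lemma memLp_of_continuous {G : Type*} [NormedAddCommGroup G] [SecondCountableTopology G]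
    {K : Set (E d)} (hK : IsCompact K) {μ : Measure (E d)} (hμ : μ K ≠ ⊤)
    {f : E d → G} (hf : Continuous f) : MemLp f 2 (μ.restrict K) := by
  have : IsFiniteMeasure (μ.restrict K) := ⟨by simpa using hμ.lt_top⟩
  obtain ⟨C, hC⟩ := hK.exists_bound_of_continuousOn hf.continuousOn
  refine MemLp.of_bound hf.aestronglyMeasurable C ?_
  filter_upwards [ae_restrict_mem hK.measurableSet] with x hx using hC x hx

/-- The smooth functions are total in `L²(μ)`. -/
lemma eq_zero_of_inner_smooth {μ : Measure (E d)} [IsFiniteMeasure μ] (f : Lp ℝ 2 μ)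
    (h : ∀ φ : E d → ℝ, ContDiff ℝ ∞ φ → ⟪f, toL2 μ φ⟫ = 0) : f = 0 := by
  have hf : Integrable f μ := (Lp.memLp f).integrable (by norm_num)
  have := ae_eq_zero_of_integral_contDiff_smul_eq_zero hf.locallyIntegrable ?_
  · exact (Lp.eq_zero_iff_ae_eq_zero).2 this
  · intro g hg hc
    rw [← h g hg, inner_toL2_right f (hg.continuous.memLp_of_hasCompactSupport hc)]
    simp

end smooth

/-! ### Hausdorff measure -/

section hausdorff

variable {X : Type*} [MetricSpace X] [MeasurableSpace X] [BorelSpace X]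
  {Y : Type*} [MetricSpace Y] [MeasurableSpace Y] [BorelSpace Y]

/-- The normalising factor depends on `n` only, so it is the same in `X` and `Y` and passes through
the bound for the unnormalised measure. -/
lemma _root_.LipschitzWith.euclideanHausdorffMeasure_image_le {f : X → Y} {c : NNReal}
    (hf : LipschitzWith c f) (n : ℕ) (s : Set X) :
    (μHE[n] : Measure Y) (f '' s) ≤ (c : ENNReal) ^ n * (μHE[n] : Measure X) s := by
  simp_rw [Measure.euclideanHausdorffMeasure_def, Measure.smul_apply, ENNReal.smul_def, smul_eq_mul]
  rw [mul_left_comm]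
  gcongr
  simpa using hf.hausdorffMeasure_image_le (d := n) (by positivity) s

end hausdorff

/-! ### Geometry of the elements -/

section geometry

variable {d : ℕ}

lemma IsPolyhedral.isCompact {K : Set (E d)} (h : IsPolyhedral K) : IsCompact K := by
  obtain ⟨S, rfl⟩ := h
  exact S.isCompact_biUnion fun s _ => s.finite_toSet.isCompact_convexHull ℝ

/-- A bounded part of a hyperplane has finite surface measure. -/
lemma surf_lt_top_of_flat (hd : 1 ≤ d) {F : Set (E d)} (hF : IsCompact F) {n : E d} (hn : n ≠ 0)
    {c : ℝ} (hc : ∀ x ∈ F, ⟪n, x⟫ = c) : surf d F < ⊤ := by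
  obtain ⟨k, rfl⟩ : ∃ k, d = k + 1 := ⟨d - 1, by omega⟩
  rcases F.eq_empty_or_nonempty with rfl | ⟨p, hp⟩
  · simp
  have : Fact (Module.finrank ℝ (E (k + 1)) = k + 1) := ⟨by simp⟩
  let V : Submodule ℝ (E (k + 1)) := (ℝ ∙ n)ᗮ
  have hV : Module.finrank ℝ V = k := Submodule.finrank_orthogonal_span_singleton hn
  let ι : V → E (k + 1) := fun v => p + v
  have hι : Isometry ι := by
    refine Isometry.of_dist_eq fun x y => ?_
    simp only [ι, dist_add_left]
    rfl
  have himg : ι '' (ι ⁻¹' F) = F := by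
    refine Set.image_preimage_eq_of_subset fun x hx => ⟨⟨x - p, ?_⟩, by simp [ι]⟩
    rw [Submodule.mem_orthogonal_singleton_iff_inner_right, inner_sub_right, hc x hx, hc p hp,
      sub_self]
  have hcl : Topology.IsClosedEmbedding ι := hι.isClosedEmbedding
  rw [← himg]
  simp only [surf, Nat.add_sub_cancel]
  rw [hι.euclideanHausdorffMeasure_image]
  -- In the full dimension of `V` the Hausdorff measure is finite on compact sets, hence the form
  -- with `finrank`.
  have h1 : (μHE[Module.finrank ℝ V] : Measure V) (ι ⁻¹' F) < ⊤ :=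
    (hcl.isCompact_preimage hF).measure_lt_top
  rwa [hV] at h1

namespace IsElement

variable {K : Set (E d)} {faces : Set (Set (E d))}

lemma isCompact (h : IsElement K faces) : IsCompact K := h.polyhedral.isCompact

lemma isCompact_frontier (h : IsElement K faces) : IsCompact (frontier K) :=
  h.isCompact.of_isClosed_subset isClosed_frontier h.isCompact.isClosed.frontier_subset

lemma surf_face_lt_top (h : IsElement K faces) (hd : 1 ≤ d) {F : Set (E d)} (hF : F ∈ faces) :
    surf d F < ⊤ := by
  obtain ⟨n, hn, c, hc⟩ := h.face_flat F hF
  exact surf_lt_top_of_flat hd (h.face_polyhedral F hF).isCompact hn hc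

lemma surf_frontier_ne_top (h : IsElement K faces) (hd : 1 ≤ d) : surf d (frontier K) ≠ ⊤ := by
  rw [← h.sUnion_faces, Set.sUnion_eq_biUnion]
  exact (measure_biUnion_lt_top h.finite_faces fun F hF => h.surf_face_lt_top hd hF).ne

lemma isFiniteMeasure_bdry (h : IsElement K faces) (hd : 1 ≤ d) : IsFiniteMeasure (bdry K) :=
  ⟨by simpa using (h.surf_frontier_ne_top hd).lt_top⟩

lemma isFiniteMeasure_vol (h : IsElement K faces) : IsFiniteMeasure (vol K) :=
  ⟨by simpa using h.isCompact.measure_lt_top⟩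

lemma volume_frontier (h : IsElement K faces) (hd : 1 ≤ d) : volume (frontier K) = 0 := by
  rw [← EuclideanSpace.euclideanHausdorffMeasure_eq_volume]
  -- Either the `d`-dimensional measure vanishes or the `(d-1)`-dimensional one is infinite.
  refine (Measure.euclideanHausdorffMeasure_zero_or_top (d₁ := d - 1) (by omega) _).resolve_right ?_
  exact h.surf_frontier_ne_top hd

lemma surf_frontier_ne_zero (h : IsElement K faces) (hd : 1 ≤ d) : surf d (frontier K) ≠ 0 := by
  have : Nonempty (Fin d) := ⟨⟨0, hd⟩⟩
  have hne : (frontier K).Nonempty := by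
    rw [nonempty_frontier_iff]
    refine ⟨h.connected.nonempty.mono interior_subset, fun hu => ?_⟩
    exact noncompact_univ (E d) (hu ▸ h.isCompact)
  rw [← h.sUnion_faces] at hne
  obtain ⟨x, F, hF, -⟩ := hne
  intro h0
  refine h.face_pos F hF (measure_mono_null ?_ h0)
  rw [← h.sUnion_faces]
  exact Set.subset_sUnion_of_mem hF

lemma face_subset (h : IsElement K faces) {F : Set (E d)} (hF : F ∈ faces) : F ⊆ frontier K := by
  rw [← h.sUnion_faces]
  exact Set.subset_sUnion_of_mem hF

lemma memLp_vol (h : IsElement K faces) {G : Type*} [NormedAddCommGroup G]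
    [SecondCountableTopology G] {f : E d → G} (hf : Continuous f) : MemLp f 2 (vol K) :=
  memLp_of_continuous h.isCompact h.isCompact.measure_lt_top.ne hf

lemma memLp_bdry (h : IsElement K faces) (hd : 1 ≤ d) {G : Type*} [NormedAddCommGroup G]
    [SecondCountableTopology G] {f : E d → G} (hf : Continuous f) : MemLp f 2 (bdry K) :=
  memLp_of_continuous h.isCompact_frontier (h.surf_frontier_ne_top hd) hf

/-- Almost everything in `K` is in the interior. -/
lemma ae_mem_interior (h : IsElement K faces) (hd : 1 ≤ d) : ∀ᵐ x ∂(vol K), x ∈ interior K := by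
  have h1 : ∀ᵐ x ∂(vol K), x ∉ frontier K :=
    ae_restrict_of_ae (measure_eq_zero_iff_ae_notMem.1 (h.volume_frontier hd))
  filter_upwards [h1, ae_restrict_mem h.isCompact.measurableSet] with x hx hK
  by_contra hi
  exact hx ⟨subset_closure hK, hi⟩

/-- A function in `L²(K)` vanishes if it is orthogonal to the smooth functions that vanish near
the boundary. -/
lemma eq_zero_of_inner_smooth_interior (h : IsElement K faces) (hd : 1 ≤ d) (f : Lp ℝ 2 (vol K))
    (hf : ∀ φ : E d → ℝ, ContDiff ℝ ∞ φ → (∀ x ∈ frontier K, φ x = 0) →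
      ⟪f, toL2 (vol K) φ⟫ = 0) : f = 0 := by
  have := h.isFiniteMeasure_vol
  have hi : Integrable f (vol K) := (Lp.memLp f).integrable (by norm_num)
  have h0 := isOpen_interior.ae_eq_zero_of_integral_contDiff_smul_eq_zero (μ := vol K) (U := interior K)
    (hi.locallyIntegrable.locallyIntegrableOn _) (f := f) ?_
  · refine (Lp.eq_zero_iff_ae_eq_zero).2 ?_
    filter_upwards [h0, h.ae_mem_interior hd] with x hx hx' using hx hx'
  · intro g hg hc hs
    have hz : ∀ x ∈ frontier K, g x = 0 := fun x hx => by
      by_contra hne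
      exact hx.2 (hs (subset_tsupport _ hne))
    rw [← hf g hg hz, inner_toL2_right f (hg.continuous.memLp_of_hasCompactSupport hc)]
    simp

/-- The divergence is determined by the field. -/
lemma dv_eq_zero (h : IsElement K faces) (hd : 1 ≤ d) {v : Triple K} (hv : v ∈ HdivL2 K)
    (h0 : field v = 0) : dv v = 0 := by
  refine h.eq_zero_of_inner_smooth_interior hd _ fun φ hφ hz => ?_
  have h1 := hv φ hφ
  have h2 : toL2 (bdry K) φ = 0 := by
    refine toL2_eq_zero ?_
    filter_upwards [ae_restrict_mem h.isCompact_frontier.measurableSet] with x hx using hz x hx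
  have h3 : v.1 = 0 := h0
  simpa [h2, h3] using h1

/-- The normal trace is determined by the field. -/
lemma ntr_eq_zero (h : IsElement K faces) (hd : 1 ≤ d) {v : Triple K} (hv : v ∈ HdivL2 K)
    (h0 : field v = 0) : ntr v = 0 := by
  have := h.isFiniteMeasure_bdry hd
  refine eq_zero_of_inner_smooth _ fun φ hφ => ?_
  have h1 := hv φ hφ
  have h3 : v.1 = 0 := h0
  have h4 : v.2.1 = 0 := h.dv_eq_zero hd hv h0
  rw [h3, h4] at h1
  simpa using h1.symm

end IsElement

end geometry

/-! ### Linear maps on finite dimensional spaces -/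

/-- On `p` the map `g` factors through the range of `f`, and a linear map on a finite dimensional
normed space is bounded. No norm on `X` is involved, so `f` may be any seminorm-like quantity. All
constants on a fixed element are obtained in this way. -/
lemma exists_norm_le_of_ker_le {X Y Z : Type*} [AddCommGroup X] [Module ℝ X]
    [NormedAddCommGroup Y] [NormedSpace ℝ Y] [NormedAddCommGroup Z] [NormedSpace ℝ Z]
    (p : Submodule ℝ X) [FiniteDimensional ℝ p] (f : X →ₗ[ℝ] Y) (g : X →ₗ[ℝ] Z)
    (h : ∀ x ∈ p, f x = 0 → g x = 0) : ∃ C, 0 ≤ C ∧ ∀ x ∈ p, ‖g x‖ ≤ C * ‖f x‖ := by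
  let f' := f.domRestrict p
  let g' := g.domRestrict p
  have hk : LinearMap.ker f' ≤ LinearMap.ker g' := fun x hx => h x x.2 hx
  let k : LinearMap.range f' →ₗ[ℝ] Z :=
    ((LinearMap.ker f').liftQ g' hk) ∘ₗ f'.quotKerEquivRange.symm.toLinearMap
  let k' := LinearMap.toContinuousLinearMap k
  refine ⟨‖k'‖, k'.opNorm_nonneg, fun x hx => ?_⟩
  have h1 : k' ⟨f' ⟨x, hx⟩, LinearMap.mem_range_self _ _⟩ = g x := by
    have h2 : f'.quotKerEquivRange.symm ⟨f' ⟨x, hx⟩, LinearMap.mem_range_self _ _⟩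
        = (LinearMap.ker f').mkQ ⟨x, hx⟩ := by
      rw [LinearEquiv.symm_apply_eq]
      rfl
    change ((LinearMap.ker f').liftQ g' hk) (f'.quotKerEquivRange.symm _) = g x
    rw [h2]
    rfl
  rw [← h1]
  exact k'.le_opNorm _

/-! ### Polynomials on an element -/

section polynomials

variable {d : ℕ} {K : Set (E d)} {faces : Set (Set (E d))}

lemma fn_add (p q : MvPolynomial (Fin d) ℝ) : fn (p + q) = fun x => fn p x + fn q x := by
  funext x; simp [fn]

lemma fn_smul (c : ℝ) (q : MvPolynomial (Fin d) ℝ) : fn (c • q) = fun x => c • fn q x := by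
  funext x; simp [fn]

lemma gradient_fn_add (p q : MvPolynomial (Fin d) ℝ) :
    gradient (fn (p + q)) = fun x => gradient (fn p) x + gradient (fn q) x := by
  funext x
  have hp := ((contDiff_fn p).differentiable (by simp)) x
  have hq := ((contDiff_fn q).differentiable (by simp)) x
  simp only [gradient, fn_add]
  rw [fderiv_fun_add hp hq, map_add]

lemma gradient_fn_smul (c : ℝ) (q : MvPolynomial (Fin d) ℝ) :
    gradient (fn (c • q)) = fun x => c • gradient (fn q) x := by
  funext x
  have hq := ((contDiff_fn q).differentiable (by simp)) x
  simp only [gradient, fn_smul]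
  rw [fderiv_fun_const_smul hq]
  simp

namespace IsElement

/-- The restriction to `K` of polynomials, as a linear map. -/
noncomputable def resₗ (h : IsElement K faces) : MvPolynomial (Fin d) ℝ →ₗ[ℝ] Lp ℝ 2 (vol K) where
  toFun := res K
  map_add' p q := by
    simp only [res, fn_add]
    exact toL2_add (h.memLp_vol (contDiff_fn p).continuous) (h.memLp_vol (contDiff_fn q).continuous)
  map_smul' c q := by
    simp only [res, fn_smul]
    exact toL2_smul c (h.memLp_vol (contDiff_fn q).continuous)

/-- The trace of polynomials, as a linear map. -/
noncomputable def trₗ (h : IsElement K faces) (hd : 1 ≤ d) :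
    MvPolynomial (Fin d) ℝ →ₗ[ℝ] Lp ℝ 2 (bdry K) where
  toFun := tr K
  map_add' p q := by
    simp only [tr, fn_add]
    exact toL2_add (h.memLp_bdry hd (contDiff_fn p).continuous)
      (h.memLp_bdry hd (contDiff_fn q).continuous)
  map_smul' c q := by
    simp only [tr, fn_smul]
    exact toL2_smul c (h.memLp_bdry hd (contDiff_fn q).continuous)

/-- The gradient of polynomials, as a linear map. -/
noncomputable def gradₗ (h : IsElement K faces) :
    MvPolynomial (Fin d) ℝ →ₗ[ℝ] Lp (E d) 2 (vol K) where
  toFun := grad K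
  map_add' p q := by
    simp only [grad, gradient_fn_add]
    exact toL2_add (h.memLp_vol (continuous_gradient (contDiff_fn p)))
      (h.memLp_vol (continuous_gradient (contDiff_fn q)))
  map_smul' c q := by
    simp only [grad, gradient_fn_smul]
    exact toL2_smul c (h.memLp_vol (continuous_gradient (contDiff_fn q)))

/-- A polynomial with vanishing gradient on `K` is constant on `K`. -/
lemma fn_eq_of_grad_eq_zero (h : IsElement K faces) {q : MvPolynomial (Fin d) ℝ}
    (hq : grad K q = 0) {x₀ : E d} (hx₀ : x₀ ∈ interior K) : ∀ x ∈ K, fn q x = fn q x₀ := by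
  have hc := continuous_gradient (contDiff_fn q)
  have h1 : gradient (fn q) =ᵐ[vol K] 0 := by
    have h2 := coeFn_toL2 (h.memLp_vol hc)
    have h3 : toL2 (vol K) (gradient (fn q)) = 0 := hq
    rw [h3] at h2
    exact h2.symm.trans (Lp.coeFn_zero _ _ _)
  have h4 : gradient (fn q) =ᵐ[volume.restrict (interior K)] 0 :=
    ae_restrict_of_ae_restrict_of_subset interior_subset h1
  -- Continuous functions that agree almost everywhere on an open set agree on it, so connectedness
  -- of the interior applies; density of the interior then reaches all of `K`.
  have h5 : Set.EqOn (gradient (fn q)) 0 (interior K) :=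
    Measure.eqOn_open_of_ae_eq h4 isOpen_interior hc.continuousOn continuousOn_const
  have h6 : ∀ x ∈ interior K, fn q x = fn q x₀ := fun x hx => by
    refine isOpen_interior.is_const_of_fderiv_eq_zero (𝕜 := ℝ) h.connected.isPreconnected
      ((contDiff_fn q).differentiable (by simp)).differentiableOn (fun y hy => ?_) hx hx₀
    have := h5 hy
    rw [← toDual_gradient, this]
    simp
  have h7 : Set.EqOn (fn q) (fun _ => fn q x₀) (closure (interior K)) :=
    Set.EqOn.closure h6 (contDiff_fn q).continuous continuous_const
  rw [h.closure_interior] at h7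
  exact h7

/-- Poincaré inequality for finite dimensional spaces of polynomials. -/
lemma exists_poincare (h : IsElement K faces) (hd : 1 ≤ d)
    (W : Submodule ℝ (MvPolynomial (Fin d) ℝ)) [FiniteDimensional ℝ W] :
    ∃ C, 0 ≤ C ∧ ∀ q ∈ W, ∃ c : ℝ,
      ‖toL2 (vol K) (fun x => fn q x - c)‖ ≤ C * ‖grad K q‖ ∧
      ‖toL2 (bdry K) (fun x => fn q x - c)‖ ≤ C * ‖grad K q‖ := by
  obtain ⟨x₀, hx₀⟩ := h.connected.nonempty
  -- Subtracting the value at an interior point is a linear normalisation that kills the kernel of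
  -- the gradient on `K`, and it provides one constant for both estimates.
  let N : MvPolynomial (Fin d) ℝ →ₗ[ℝ] MvPolynomial (Fin d) ℝ :=
    LinearMap.id - (Algebra.linearMap ℝ _) ∘ₗ (MvPolynomial.aeval (fun i => x₀ i)).toLinearMap
  have hN : ∀ q, fn (N q) = fun x => fn q x - fn q x₀ := fun q => by
    funext x
    simp [N, fn, MvPolynomial.algebraMap_eq]
  have hz : ∀ q, grad K q = 0 → ∀ x ∈ K, fn (N q) x = 0 := fun q hq x hx => by
    simp only [hN, h.fn_eq_of_grad_eq_zero hq hx₀ x hx, sub_self]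
  obtain ⟨C₁, hC₁, h₁⟩ := exists_norm_le_of_ker_le W h.gradₗ (h.resₗ ∘ₗ N) fun q _ hq => by
    refine toL2_eq_zero ?_
    filter_upwards [ae_restrict_mem h.isCompact.measurableSet] with x hx using hz q hq x hx
  obtain ⟨C₂, hC₂, h₂⟩ := exists_norm_le_of_ker_le W h.gradₗ (h.trₗ hd ∘ₗ N) fun q _ hq => by
    refine toL2_eq_zero ?_
    filter_upwards [ae_restrict_mem h.isCompact_frontier.measurableSet] with x hx
      using hz q hq x (h.isCompact.isClosed.frontier_subset hx)
  refine ⟨max C₁ C₂, le_max_of_le_left hC₁, fun q hq => ⟨fn q x₀, ?_, ?_⟩⟩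
  · rw [← hN q]
    exact (h₁ q hq).trans (mul_le_mul_of_nonneg_right (le_max_left _ _) (norm_nonneg _))
  · rw [← hN q]
    exact (h₂ q hq).trans (mul_le_mul_of_nonneg_right (le_max_right _ _) (norm_nonneg _))

end IsElement

end polynomials

/-! ### Stability on a single element -/

namespace LocalSpaces

variable {d : ℕ} (S : LocalSpaces d)

/-- Green's formula for the local spaces. -/
lemma green {v : Triple S.K} (hv : v ∈ S.V) (w : MvPolynomial (Fin d) ℝ) :
    ⟪field v, grad S.K w⟫ + ⟪dv v, res S.K w⟫ = ⟪ntr v, tr S.K w⟫ :=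
  S.V_le hv (fn w) (contDiff_fn w)

lemma ae_face_of_ae_bdry {F : Set (E d)} (hF : F ∈ S.faces) {p : E d → Prop}
    (h : ∀ᵐ x ∂(bdry S.K), p x) : ∀ᵐ x ∂((surf d).restrict F), p x :=
  ae_restrict_of_ae_restrict_of_subset (S.isElement.face_subset hF) h

lemma memLp_face {F : Set (E d)} (hF : F ∈ S.faces) (μ : Lp ℝ 2 (bdry S.K)) :
    MemLp μ 2 ((surf d).restrict F) :=
  (Lp.memLp μ).mono_measure (Measure.restrict_mono (S.isElement.face_subset hF) le_rfl)

lemma sub_mem_M {μ η : Lp ℝ 2 (bdry S.K)} (hμ : μ ∈ S.M) (hη : η ∈ S.M) : μ - η ∈ S.M := by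
  intro F hF
  have h1 : toL2 ((surf d).restrict F) (μ - η : Lp ℝ 2 (bdry S.K)) =
      toL2 ((surf d).restrict F) μ - toL2 ((surf d).restrict F) η := by
    rw [← toL2_sub (S.memLp_face hF μ) (S.memLp_face hF η)]
    exact toL2_congr (S.ae_face_of_ae_bdry hF (Lp.coeFn_sub μ η))
  rw [h1]
  exact (S.MF F).sub_mem (hμ F hF) (hη F hF)

/-- `S.Vperp V'` as a subspace. -/
def vperp (V' : Submodule ℝ (Triple S.K)) : Submodule ℝ (Triple S.K) where
  carrier := S.Vperp V'
  add_mem' := by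
    rintro a b ⟨ha, ha'⟩ ⟨hb, hb'⟩
    refine ⟨S.V.add_mem ha hb, fun v' hv' => ?_⟩
    have h1 := ha' v' hv'
    have h2 := hb' v' hv'
    simp only [field, Prod.fst_add, inner_add_left] at h1 h2 ⊢
    rw [h1, h2, add_zero]
  zero_mem' := ⟨S.V.zero_mem, fun v' _ => by simp [field]⟩
  smul_mem' := by
    rintro c a ⟨ha, ha'⟩
    refine ⟨S.V.smul_mem c ha, fun v' hv' => ?_⟩
    have h1 := ha' v' hv'
    simp only [field, Prod.smul_fst, real_inner_smul_left] at h1 ⊢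
    rw [h1, mul_zero]

/-- `S.Wperp W'` as a subspace. -/
def wperp (W' : Submodule ℝ (MvPolynomial (Fin d) ℝ)) :
    Submodule ℝ (MvPolynomial (Fin d) ℝ) where
  carrier := S.Wperp W'
  add_mem' := by
    rintro a b ⟨ha, ha'⟩ ⟨hb, hb'⟩
    refine ⟨S.W.add_mem ha hb, fun w' hw' => ?_⟩
    have h1 : res S.K (a + b) = res S.K a + res S.K b := S.isElement.resₗ.map_add a b
    rw [h1, inner_add_left, ha' w' hw', hb' w' hw', add_zero]
  zero_mem' := by
    refine ⟨S.W.zero_mem, fun w' _ => ?_⟩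
    have h1 : res S.K 0 = 0 := S.isElement.resₗ.map_zero
    rw [h1, inner_zero_left]
  smul_mem' := by
    rintro c a ⟨ha, ha'⟩
    refine ⟨S.W.smul_mem c ha, fun w' hw' => ?_⟩
    have h1 : res S.K (c • a) = c • res S.K a := S.isElement.resₗ.map_smul c a
    rw [h1, real_inner_smul_left, ha' w' hw', mul_zero]

/-- The field, as a linear map. -/
noncomputable def fieldₗ (K : Set (E d)) : Triple K →ₗ[ℝ] Lp (E d) 2 (vol K) := LinearMap.fst ℝ _ _

/-- The normal trace, as a linear map. -/
noncomputable def ntrₗ (K : Set (E d)) : Triple K →ₗ[ℝ] Lp ℝ 2 (bdry K) :=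
  LinearMap.snd ℝ _ _ ∘ₗ LinearMap.snd ℝ _ _

/-- The projection onto the stabilization space, as a linear map. -/
noncomputable def PMSₗ : Lp ℝ 2 (bdry S.K) →ₗ[ℝ] Lp ℝ 2 (bdry S.K) := S.MS.starProjection.toLinearMap

variable {S}

/-- Uniqueness in the decomposition of the zero trace, applied to `(v, 0)` and `(0, 0)`. It makes
`‖v·n‖` a norm on the complement of `V'`. -/
lemma IsMDecomposition.eq_zero_of_ntr {V' : Submodule ℝ (Triple S.K)}
    {W' : Submodule ℝ (MvPolynomial (Fin d) ℝ)} (h : S.IsMDecomposition V' W') (hd : 1 ≤ d)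
    {v : Triple S.K} (hv : v ∈ S.vperp V') (h0 : ntr v = 0) : v = 0 := by
  have htr : tr S.K 0 = 0 := (S.isElement.trₗ hd).map_zero
  have h1 : (0 : Lp ℝ 2 (bdry S.K)) ∈ S.M := by
    have := h.trace_mem 0 S.V.zero_mem 0 S.W.zero_mem
    rwa [htr, add_zero] at this
  have h2 := (h.trace_bij 0 h1).unique (y₁ := (v, 0)) (y₂ := (0, 0))
    ⟨hv, (S.wperp W').zero_mem, by simp [h0, htr]⟩
    ⟨(S.vperp V').zero_mem, (S.wperp W').zero_mem, by simp [ntr, htr]⟩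
  exact congrArg Prod.fst h2

/-- Green's formula writes the pairing as `(v, ∇w) + (∇·v, w)`, and both terms vanish because `∇w ∈
V'` and `∇·v ∈ W'`. -/
lemma IsMDecomposition.inner_ntr_tr {V' : Submodule ℝ (Triple S.K)}
    {W' : Submodule ℝ (MvPolynomial (Fin d) ℝ)} (h : S.IsMDecomposition V' W')
    {v : Triple S.K} (hv : v ∈ S.Vperp V') {w : MvPolynomial (Fin d) ℝ} (hw : w ∈ S.Wperp W') :
    ⟪ntr v, tr S.K w⟫ = 0 := by
  rw [← S.green hv.1]
  obtain ⟨v', hv', hvw⟩ := h.grad_mem w hw.1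
  obtain ⟨w', hw', hwv⟩ := h.div_mem v hv.1
  rw [← hvw, ← hwv, hv.2 v' hv', real_inner_comm, hw.2 w' hw', add_zero]

/-- The stability estimate for the discrete gradient on a single element. -/
theorem IsAdmissible.exists_stability (hS : S.IsAdmissible) (hd : 1 ≤ d) :
    ∃ C, 0 ≤ C ∧ ∀ q ∈ S.W, ∀ μ ∈ S.M, ∀ g : Lp (E d) 2 (vol S.K),
      (∀ G ∈ S.V, ⟪g, field G⟫ + ⟪grad S.K q, field G⟫ + ⟪μ - tr S.K q, ntr G⟫ = 0) →
        ‖grad S.K q‖ ≤ C * (‖g‖ + ‖S.PMS (tr S.K q - μ)‖) ∧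
        ‖tr S.K q - μ‖ ≤ C * (‖g‖ + ‖S.PMS (tr S.K q - μ)‖) := by
  obtain ⟨V', W', hD, -, -, hP⟩ := hS
  have := S.finV
  have := S.finW
  have hVle : S.vperp V' ≤ S.V := fun v hv => hv.1
  have hWle : S.wperp W' ≤ S.W := fun w hw => hw.1
  have := Submodule.finiteDimensional_of_le hVle
  have := Submodule.finiteDimensional_of_le hWle
  obtain ⟨C₁, hC₁, h₁⟩ := exists_norm_le_of_ker_le (S.vperp V') (ntrₗ S.K) (fieldₗ S.K)
    fun v hv h0 => by rw [hD.eq_zero_of_ntr hd hv h0, map_zero]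
  obtain ⟨C₂, hC₂, h₂⟩ := exists_norm_le_of_ker_le (S.wperp W') (S.PMSₗ ∘ₗ S.isElement.trₗ hd)
    (S.isElement.trₗ hd) fun w hw h0 => by
      have : ‖S.PMS (tr S.K w)‖ = 0 := norm_eq_zero.2 h0
      rw [hP w hw this, map_zero]
  -- A discrete trace inequality; it is available because a field in `V` determines its normal
  -- trace.
  obtain ⟨C₃, hC₃, h₃⟩ := exists_norm_le_of_ker_le S.V (fieldₗ S.K) (ntrₗ S.K)
    fun v hv h0 => S.isElement.ntr_eq_zero hd (S.V_le hv) h0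
  have key : ∀ q ∈ S.W, ∀ μ ∈ S.M, ∀ g : Lp (E d) 2 (vol S.K),
      (∀ G ∈ S.V, ⟪g, field G⟫ + ⟪grad S.K q, field G⟫ + ⟪μ - tr S.K q, ntr G⟫ = 0) →
        ‖tr S.K q - μ‖ ≤ (C₁ + C₂ + C₂ * C₁) * (‖g‖ + ‖S.PMS (tr S.K q - μ)‖) := by
    intro q hq μ hμ g hg
    set η := tr S.K q - μ with hη
    have hηM : η ∈ S.M := by
      refine S.sub_mem_M ?_ hμ
      have := hD.trace_mem 0 S.V.zero_mem q hq
      simpa [ntr] using this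
    obtain ⟨⟨v, w⟩, hp, -⟩ := hD.trace_bij η hηM
    obtain ⟨hv, hw, hvw⟩ : v ∈ S.Vperp V' ∧ w ∈ S.Wperp W' ∧ ntr v + tr S.K w = η := hp
    obtain ⟨v', hv', hvq⟩ := hD.grad_mem q hq
    have horth := hD.inner_ntr_tr hv hw
    have hntr : ‖ntr v‖ ≤ C₁ * ‖g‖ := by
      -- The test field is the `V`-part of the jump itself: it is orthogonal to `∇q`, and its normal
      -- trace is orthogonal to `w`, so only `‖v·n‖²` and `(g, v)` remain.
      have e1 := hg v hv.1
      rw [← hvq, real_inner_comm (field v) (field v'), hv.2 v' hv', ← neg_sub, ← hη, ← hvw, inner_neg_left,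
        inner_add_left, real_inner_self_eq_norm_sq, real_inner_comm (ntr v) (tr S.K w), horth] at e1
      have e2 : ‖ntr v‖ ^ 2 = ⟪g, field v⟫ := by
        linarith
      have e3 : ⟪g, field v⟫ ≤ ‖g‖ * (C₁ * ‖ntr v‖) :=
        (real_inner_le_norm _ _).trans (mul_le_mul_of_nonneg_left (h₁ v hv) (norm_nonneg _))
      by_contra hlt
      push Not at hlt
      have e4 : 0 < ‖ntr v‖ := (by positivity : 0 ≤ C₁ * ‖g‖).trans_lt hlt
      nlinarith
    have htr : ‖tr S.K w‖ ≤ C₂ * (‖S.PMS η‖ + ‖ntr v‖) := by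
      refine (h₂ w hw).trans (mul_le_mul_of_nonneg_left ?_ hC₂)
      have e1 : S.PMSₗ (tr S.K w) = S.PMS η - S.PMSₗ (ntr v) := by
        have : tr S.K w = η - ntr v := by rw [← hvw]; simp
        rw [this, map_sub]; rfl
      change ‖S.PMSₗ (tr S.K w)‖ ≤ _
      rw [e1]
      refine (norm_sub_le _ _).trans (add_le_add_right ?_ _)
      exact S.MS.norm_starProjection_apply_le _
    have hsum : ‖η‖ ≤ ‖ntr v‖ + ‖tr S.K w‖ := by rw [← hvw]; exact norm_add_le _ _
    have hb : ‖tr S.K w‖ ≤ C₂ * (‖S.PMS η‖ + C₁ * ‖g‖) :=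
      htr.trans (mul_le_mul_of_nonneg_left (add_le_add_right hntr _) hC₂)
    have p1 := mul_nonneg hC₁ (norm_nonneg (S.PMS η))
    have p2 := mul_nonneg hC₂ (norm_nonneg g)
    have p3 := mul_nonneg (mul_nonneg hC₂ hC₁) (norm_nonneg (S.PMS η))
    linarith
  set C₄ := C₁ + C₂ + C₂ * C₁ with hC₄
  have hC₄0 : 0 ≤ C₄ := by positivity
  -- `C₄` is for the jump, and `1 + C₃ C₄` for the gradient: the terms come from `(g, ∇q)` and from
  -- the boundary pairing.
  refine ⟨C₄ + 1 + C₃ * C₄, by positivity, fun q hq μ hμ g hg => ?_⟩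
  have hk := key q hq μ hμ g hg
  set D := ‖g‖ + ‖S.PMS (tr S.K q - μ)‖ with hDdef
  have hD0 : 0 ≤ D := by positivity
  constructor
  -- The gradient is an admissible test field, which produces `‖∇q‖²`.
  · obtain ⟨v', hv', hvq⟩ := hD.grad_mem q hq
    have hvV := hD.V'_le hv'
    have e1 := hg v' hvV
    rw [hvq, real_inner_self_eq_norm_sq, ← neg_sub, inner_neg_left] at e1
    have e2 : ⟪tr S.K q - μ, ntr v'⟫ ≤ (C₄ * D) * (C₃ * ‖grad S.K q‖) := by
      refine (real_inner_le_norm _ _).trans (mul_le_mul hk ?_ (norm_nonneg _) (by positivity))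
      rw [← hvq]
      exact h₃ v' hvV
    have e3 : -⟪g, grad S.K q⟫ ≤ ‖g‖ * ‖grad S.K q‖ := by
      rw [← inner_neg_left, ← norm_neg g]
      exact real_inner_le_norm _ _
    have e4 : ‖g‖ ≤ D := by rw [hDdef]; linarith [norm_nonneg (S.PMS (tr S.K q - μ))]
    have e5 : ‖g‖ * ‖grad S.K q‖ ≤ D * ‖grad S.K q‖ :=
      mul_le_mul_of_nonneg_right e4 (norm_nonneg _)
    by_contra hlt
    push Not at hlt
    have e6 : 0 < ‖grad S.K q‖ := (by positivity : 0 ≤ (C₄ + 1 + C₃ * C₄) * D).trans_lt hlt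
    have e7 := mul_lt_mul_of_pos_right hlt e6
    have e8 : 0 ≤ C₄ * D * ‖grad S.K q‖ := by positivity
    nlinarith
  · refine hk.trans (mul_le_mul_of_nonneg_right ?_ hD0)
    have : 0 ≤ C₃ * C₄ := by positivity
    linarith

end LocalSpaces

/-! ### Affine changes of variables -/

section pullback

variable {d : ℕ} {G : Type*} [NormedAddCommGroup G] {μ ν : Measure (E d)}
  {A : E d ≃ᵃ[ℝ] E d} {c : NNReal}

lemma measurable_affineEquiv (A : E d ≃ᵃ[ℝ] E d) : Measurable A :=
  A.toContinuousAffineEquiv.toHomeomorph.continuous.measurable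

lemma measurableEmbedding_affineEquiv (A : E d ≃ᵃ[ℝ] E d) : MeasurableEmbedding A :=
  A.toContinuousAffineEquiv.toHomeomorph.measurableEmbedding

lemma contDiff_affineEquiv (A : E d ≃ᵃ[ℝ] E d) : ContDiff ℝ ∞ A :=
  A.toContinuousAffineEquiv.toContinuousAffineMap.contDiff

lemma ae_comp_of_map_le (H : μ.map A ≤ c • ν) {p : E d → Prop} (h : ∀ᵐ y ∂ν, p y) :
    ∀ᵐ x ∂μ, p (A x) := by
  have h1 : ∀ᵐ y ∂(μ.map A), p y :=
    (Measure.absolutelyContinuous_of_le H).ae_le (Measure.smul_absolutelyContinuous.ae_le h)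
  exact ae_of_ae_map (measurable_affineEquiv A).aemeasurable h1

lemma _root_.MeasureTheory.MemLp.comp_of_map_le (H : μ.map A ≤ c • ν) {f : E d → G}
    (hf : MemLp f 2 ν) : MemLp (fun x => f (A x)) 2 μ := by
  have h1 : MemLp f 2 (μ.map A) := hf.of_measure_le_smul (c := c) ENNReal.coe_ne_top H
  exact (memLp_map_measure_iff h1.1 (measurable_affineEquiv A).aemeasurable).1 h1

lemma norm_toL2_comp_sq_le [InnerProductSpace ℝ G] (H : μ.map A ≤ c • ν) {f : E d → G}
    (hf : MemLp f 2 ν) : ‖toL2 μ (fun x => f (A x))‖ ^ 2 ≤ c * ‖toL2 ν f‖ ^ 2 := by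
  have hi := integrable_norm_sq hf
  rw [norm_toL2_sq hf, norm_toL2_sq (hf.comp_of_map_le H),
    ← (measurableEmbedding_affineEquiv A).integral_map (fun y => ‖f y‖ ^ 2)]
  refine (integral_mono_measure H (Filter.Eventually.of_forall fun x => by positivity)
    (hi.smul_measure_nnreal)).trans_eq ?_
  rw [integral_smul_nnreal_measure]
  rfl

/-- The composition with `A` as a bounded operator between `L²` spaces. -/
noncomputable def pull (H : μ.map A ≤ c • ν) : Lp ℝ 2 ν →L[ℝ] Lp ℝ 2 μ :=
  LinearMap.mkContinuous
    { toFun := fun f => toL2 μ (fun x => f (A x))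
      map_add' := fun f g => by
        rw [← toL2_add ((Lp.memLp f).comp_of_map_le H) ((Lp.memLp g).comp_of_map_le H)]
        exact toL2_congr (ae_comp_of_map_le H (Lp.coeFn_add f g))
      map_smul' := fun a f => by
        rw [RingHom.id_apply, ← toL2_smul a ((Lp.memLp f).comp_of_map_le H)]
        exact toL2_congr (ae_comp_of_map_le H (Lp.coeFn_smul a f)) }
    (Real.sqrt c) fun f => by
      refine le_of_sq_le_sq ?_ (by positivity)
      rw [mul_pow, Real.sq_sqrt c.coe_nonneg]
      have := norm_toL2_comp_sq_le H (Lp.memLp f)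
      rwa [toL2_coeFn] at this

lemma pull_apply (H : μ.map A ≤ c • ν) (f : Lp ℝ 2 ν) :
    pull H f = toL2 μ (fun x => f (A x)) := rfl

lemma pull_toL2 (H : μ.map A ≤ c • ν) {f : E d → ℝ} (hf : MemLp f 2 ν) :
    pull H (toL2 ν f) = toL2 μ (fun x => f (A x)) :=
  toL2_congr (ae_comp_of_map_le H (coeFn_toL2 hf))

lemma norm_pull_sq_le (H : μ.map A ≤ c • ν) : ‖pull H‖ ^ 2 ≤ c := by
  have h1 : ‖pull H‖ ≤ Real.sqrt c := LinearMap.mkContinuous_norm_le _ (Real.sqrt_nonneg _) _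
  calc (‖pull H‖ ^ 2 : ℝ) ≤ (Real.sqrt c) ^ 2 := by gcongr
    _ = c := Real.sq_sqrt c.coe_nonneg

/-- Stabilization spaces that are transported as surface densities: the projection of the
composition with `A` is controlled by the projection. -/
lemma norm_starProjection_pull_sq_le [IsFiniteMeasure ν] (H : μ.map A ≤ c • ν)
    (hν : ∀ φ : E d → ℝ, ContDiff ℝ ∞ φ → MemLp φ 2 ν)
    (P : Submodule ℝ (Lp ℝ 2 ν)) (Q : Submodule ℝ (Lp ℝ 2 μ))
    [P.HasOrthogonalProjection] [Q.HasOrthogonalProjection]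
    (hQP : ∀ m ∈ Q, ∃ η ∈ P, ∀ φ : E d → ℝ, ContDiff ℝ ∞ φ →
      ⟪η, toL2 ν φ⟫ = ⟪m, toL2 μ (φ ∘ A)⟫) (η : Lp ℝ 2 ν) :
    ‖Q.starProjection (pull H η)‖ ^ 2 ≤ c * ‖P.starProjection η‖ ^ 2 := by
  set m := Q.starProjection (pull H η) with hm
  have hmQ : m ∈ Q := Q.starProjection_apply_mem _
  obtain ⟨ζ, hζ, hζφ⟩ := hQP m hmQ
  -- Transport as densities says exactly that `ζ` is the adjoint pull-back of `m`, since smooth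
  -- functions are total.
  have hadj : ζ = (pull H).adjoint m := by
    rw [← sub_eq_zero]
    refine eq_zero_of_inner_smooth _ fun φ hφ => ?_
    rw [inner_sub_left, hζφ φ hφ, ContinuousLinearMap.adjoint_inner_left, pull_toL2 H (hν φ hφ)]
    exact sub_self _
  -- Both sides equal `⟪m, pull η⟫`: `Q` fixes `m`, and `P` fixes `ζ`.
  have h1 : ‖m‖ ^ 2 = ⟪ζ, P.starProjection η⟫ := by
    rw [← real_inner_self_eq_norm_sq]
    nth_rw 2 [hm]
    rw [← Submodule.inner_starProjection_left_eq_right, Submodule.starProjection_eq_self_iff.2 hmQ,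
      ← Submodule.inner_starProjection_left_eq_right, Submodule.starProjection_eq_self_iff.2 hζ,
      hadj, ContinuousLinearMap.adjoint_inner_left]
  have h2 : ‖ζ‖ ≤ ‖pull H‖ * ‖m‖ := by
    rw [hadj]
    refine (ContinuousLinearMap.le_opNorm _ _).trans_eq ?_
    rw [LinearIsometryEquiv.norm_map]
  have h3 : ‖m‖ ^ 2 ≤ ‖pull H‖ * ‖m‖ * ‖P.starProjection η‖ := by
    rw [h1]
    exact (real_inner_le_norm _ _).trans (mul_le_mul_of_nonneg_right h2 (norm_nonneg _))
  have h4 : ‖m‖ ≤ ‖pull H‖ * ‖P.starProjection η‖ := by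
    by_contra hlt
    push Not at hlt
    have h5 : 0 < ‖m‖ := (by positivity : 0 ≤ ‖pull H‖ * ‖P.starProjection η‖).trans_lt hlt
    nlinarith
  calc ‖m‖ ^ 2 ≤ (‖pull H‖ * ‖P.starProjection η‖) ^ 2 := by gcongr
    _ = ‖pull H‖ ^ 2 * ‖P.starProjection η‖ ^ 2 := mul_pow _ _ _
    _ ≤ c * ‖P.starProjection η‖ ^ 2 := by gcongr; exact norm_pull_sq_le H

lemma norm_toL2_sq_le_of_norm_le {G' : Type*} [NormedAddCommGroup G'] [InnerProductSpace ℝ G]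
    [InnerProductSpace ℝ G'] {f : E d → G} {g : E d → G'} (hf : MemLp f 2 μ) (hg : MemLp g 2 μ)
    {a : ℝ} (h : ∀ᵐ x ∂μ, ‖f x‖ ≤ a * ‖g x‖) :
    ‖toL2 μ f‖ ^ 2 ≤ a ^ 2 * ‖toL2 μ g‖ ^ 2 := by
  rw [norm_toL2_sq hf, norm_toL2_sq hg, ← integral_const_mul]
  refine integral_mono_ae (integrable_norm_sq hf) ((integrable_norm_sq hg).const_mul _) ?_
  filter_upwards [h] with x hx
  rw [← mul_pow]
  gcongr

end pullback

section geometry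

variable {d : ℕ} {A : E d ≃ᵃ[ℝ] E d}

/-- The preimage under `A` is an image under the Lipschitz map `A⁻¹`. This one-sided bound, used for
`A` and for `A.symm`, replaces a surface Jacobian on the faces. -/
lemma map_restrict_le {γ : NNReal} (hγ : LipschitzWith γ A.symm) (n : ℕ) (s : Set (E d)) :
    ((μHE[n] : Measure (E d)).restrict s).map A ≤ γ ^ n • (μHE[n] : Measure (E d)).restrict (A '' s) := by
  refine Measure.le_iff.2 fun t ht => ?_
  rw [Measure.map_apply (measurable_affineEquiv A) ht,
    Measure.restrict_apply (measurable_affineEquiv A ht), Measure.smul_apply,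
    Measure.restrict_apply ht]
  have : A ⁻¹' t ∩ s = A.symm '' (t ∩ A '' s) := by
    ext x
    constructor
    · rintro ⟨h1, h2⟩
      exact ⟨A x, ⟨h1, Set.mem_image_of_mem _ h2⟩, by simp⟩
    · rintro ⟨_, ⟨h1, y, hy, rfl⟩, rfl⟩
      simpa using ⟨h1, hy⟩
  rw [this]
  refine (hγ.euclideanHausdorffMeasure_image_le n _).trans_eq ?_
  rw [ENNReal.smul_def, smul_eq_mul, ENNReal.coe_pow]

lemma norm_linear_le (A : E d ≃ᵃ[ℝ] E d) {x : E d} {ρ : ℝ} (hρ : 0 < ρ) {K : Set (E d)}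
    (hb : Metric.ball x ρ ⊆ K) (hK : Bornology.IsBounded (A '' K)) (v : E d) :
    ‖A.linear v‖ ≤ 2 * Metric.diam (A '' K) / ρ * ‖v‖ := by
  rcases eq_or_ne v 0 with rfl | hv
  · simp
  have hv' : 0 < ‖v‖ := norm_pos_iff.2 hv
  -- A step of length `ρ / 2` from the centre stays in the open ball, and its image has length at
  -- most the diameter; hence the factor `2`.
  set t : ℝ := ρ / (2 * ‖v‖) with ht
  have ht0 : 0 < t := by positivity
  have h1 : t • v + x ∈ Metric.ball x ρ := by
    rw [mem_ball_iff_norm, add_sub_cancel_right, norm_smul, Real.norm_of_nonneg ht0.le, ht]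
    field_simp
    linarith
  have h2 := Metric.dist_le_diam_of_mem hK (Set.mem_image_of_mem A (hb h1))
    (Set.mem_image_of_mem A (hb (Metric.mem_ball_self hρ)))
  have h3 : A (t • v + x) = t • A.linear v + A x := by
    have := A.map_vadd x (t • v)
    simpa using this
  rw [h3, dist_eq_norm, add_sub_cancel_right, norm_smul, Real.norm_of_nonneg ht0.le, ht] at h2
  rw [div_mul_eq_mul_div, div_le_iff₀ (by positivity)] at h2
  rw [div_mul_eq_mul_div, le_div_iff₀ hρ]
  linarith

lemma lipschitzWith_of_norm_linear_le (A : E d ≃ᵃ[ℝ] E d) {c : NNReal}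
    (h : ∀ v, ‖A.linear v‖ ≤ c * ‖v‖) : LipschitzWith c A := by
  refine LipschitzWith.of_dist_le_mul fun x y => ?_
  have : A x - A y = A.linear (x - y) := by
    have := A.toAffineMap.linearMap_vsub x y
    simpa using this.symm
  rw [dist_eq_norm, dist_eq_norm, this]
  exact h _

lemma frontier_image (A : E d ≃ᵃ[ℝ] E d) (K : Set (E d)) :
    frontier (A '' K) = A '' frontier K :=
  (A.toContinuousAffineEquiv.toHomeomorph.image_frontier K).symm

/-- The linear part as a continuous linear map. -/
noncomputable def lin (A : E d ≃ᵃ[ℝ] E d) : E d →L[ℝ] E d :=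
  LinearMap.toContinuousLinearMap A.linear.toLinearMap

lemma lin_apply (A : E d ≃ᵃ[ℝ] E d) (v : E d) : lin A v = A.linear v := rfl

lemma hasFDerivAt_affineEquiv (A : E d ≃ᵃ[ℝ] E d) (x : E d) : HasFDerivAt A (lin A) x := by
  have h1 : (A : E d → E d) = fun y => lin A y + A 0 := by
    funext y
    have := A.map_vadd 0 y
    simpa [lin_apply] using this
  rw [h1]
  exact (lin A).hasFDerivAt.add_const _

lemma inner_gradient_comp {φ : E d → ℝ} (hφ : ContDiff ℝ ∞ φ) (x v : E d) :
    ⟪v, gradient (φ ∘ A) x⟫ = ⟪A.linear v, gradient φ (A x)⟫ := by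
  rw [inner_gradient_right, inner_gradient_right]
  have h1 := (hφ.differentiable (by simp) (A x)).hasFDerivAt.comp x (hasFDerivAt_affineEquiv A x)
  rw [h1.fderiv]
  rfl

/-- The change of variables formula. -/
lemma exists_setIntegral_image (A : E d ≃ᵃ[ℝ] E d) :
    ∃ δ : ℝ, 0 < δ ∧ ∀ K : Set (E d), MeasurableSet K → ∀ f : E d → ℝ,
      ∫ x in A '' K, f x = δ * ∫ x in K, f (A x) := by
  refine ⟨|(lin A).det|, ?_, fun K hK f => ?_⟩
  · rw [abs_pos]
    exact (LinearEquiv.isUnit_det' A.linear).ne_zero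
  · rw [integral_image_eq_integral_abs_det_fderiv_smul volume hK
      (fun x _ => (hasFDerivAt_affineEquiv A x).hasFDerivWithinAt) A.injective.injOn f]
    simp only [smul_eq_mul]
    rw [integral_const_mul]

end geometry

/-! ### Averages -/

section average

variable {α : Type*} [MeasurableSpace α] {μ : Measure α} [IsFiniteMeasure μ] {f : α → ℝ}

lemma norm_toL2_const_sq (a : ℝ) : ‖toL2 μ (fun _ => a)‖ ^ 2 = a ^ 2 * μ.real Set.univ := by
  rw [norm_toL2_sq (memLp_const a)]
  simp [mul_comm]

/-- The average is the best approximation by constants in `L²(μ)`. -/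
lemma norm_toL2_sub_average_sq (hf : MemLp f 2 μ) (c : ℝ) :
    ‖toL2 μ (fun x => f x - c)‖ ^ 2 =
      ‖toL2 μ (fun x => f x - ⨍ y, f y ∂μ)‖ ^ 2 + (c - ⨍ y, f y ∂μ) ^ 2 * μ.real Set.univ := by
  set m := ⨍ y, f y ∂μ with hm
  have hfm : MemLp (fun x => f x - m) 2 μ := hf.sub (memLp_const m)
  have hfc : MemLp (fun x => f x - c) 2 μ := hf.sub (memLp_const c)
  have hi : Integrable (fun x => f x - m) μ := hfm.integrable (by norm_num)
  have h0 : ∫ x, (f x - m) ∂μ = 0 := integral_sub_average μ f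
  rw [norm_toL2_sq hfc, norm_toL2_sq hfm]
  have h1 : ∀ x, ‖f x - c‖ ^ 2 = ‖f x - m‖ ^ 2 + (2 * (m - c) * (f x - m) + (c - m) ^ 2) := fun x => by
    simp only [Real.norm_eq_abs, sq_abs]; ring
  simp only [h1]
  have h2 : Integrable (fun x => 2 * (m - c) * (f x - m)) μ := hi.const_mul _
  have h3 : Integrable (fun x => 2 * (m - c) * (f x - m) + (c - m) ^ 2) μ :=
    h2.add (integrable_const _)
  rw [integral_add (integrable_norm_sq hfm) h3, integral_add h2 (integrable_const _),
    integral_const_mul, h0]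
  simp [mul_comm]

end average

lemma IsElement.diam_pos {d : ℕ} {K : Set (E d)} {faces : Set (Set (E d))}
    (h : IsElement K faces) (hd : 1 ≤ d) : 0 < Metric.diam K := by
  have : Nonempty (Fin d) := ⟨⟨0, hd⟩⟩
  obtain ⟨x, hx⟩ := h.connected.nonempty
  obtain ⟨ρ, hρ, hb⟩ := Metric.isOpen_iff.1 isOpen_interior x hx
  obtain ⟨v, hv⟩ := exists_ne (0 : E d)
  -- For the identity map the bound reads `‖v‖ ≤ 2 diam K / ρ * ‖v‖`, which fails for `v ≠ 0` if the
  -- diameter is zero.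
  have h1 := norm_linear_le (AffineEquiv.refl ℝ (E d)) hρ (hb.trans interior_subset)
    (by simpa using h.isCompact.isBounded) v
  have hv' : 0 < ‖v‖ := norm_pos_iff.2 hv
  by_contra hlt
  have h0 : Metric.diam K = 0 := le_antisymm (not_lt.1 hlt) Metric.diam_nonneg
  simp [h0] at h1
  exact hv h1

/-! ### Piola transport to the reference element -/

namespace LocalSpaces

variable {d : ℕ} {R S : LocalSpaces d} {A : E d ≃ᵃ[ℝ] E d}

namespace IsAffineImage

lemma frontier_eq (hI : R.IsAffineImage S A) : frontier S.K = A '' frontier R.K := by rw [hI.K_eq, frontier_image]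

lemma image_symm (hI : R.IsAffineImage S A) : A.symm '' S.K = R.K := by
  rw [hI.K_eq]
  ext x; simp

lemma image_symm_frontier (hI : R.IsAffineImage S A) : A.symm '' frontier S.K = frontier R.K := by
  rw [hI.frontier_eq]
  ext x; simp

lemma map_vol_le (hI : R.IsAffineImage S A) {γ : NNReal} (hγ : LipschitzWith γ A.symm) :
    (vol R.K).map A ≤ γ ^ d • vol S.K := by
  have := map_restrict_le hγ d R.K
  rwa [← hI.K_eq, EuclideanSpace.euclideanHausdorffMeasure_eq_volume] at this

lemma map_bdry_le (hI : R.IsAffineImage S A) {γ : NNReal} (hγ : LipschitzWith γ A.symm) :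
    (bdry R.K).map A ≤ γ ^ (d - 1) • bdry S.K := by
  have := map_restrict_le hγ (d - 1) (frontier R.K)
  rwa [← hI.frontier_eq] at this

lemma map_symm_vol_le (hI : R.IsAffineImage S A) {β : NNReal} (hβ : LipschitzWith β A) :
    (vol S.K).map A.symm ≤ β ^ d • vol R.K := by
  have := map_restrict_le (A := A.symm) hβ d S.K
  rwa [hI.image_symm, EuclideanSpace.euclideanHausdorffMeasure_eq_volume] at this

lemma map_symm_bdry_le (hI : R.IsAffineImage S A) {β : NNReal} (hβ : LipschitzWith β A) :
    (bdry S.K).map A.symm ≤ β ^ (d - 1) • bdry R.K := by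
  have := map_restrict_le (A := A.symm) hβ (d - 1) (frontier S.K)
  rwa [hI.image_symm_frontier] at this

/-- The pull-back of a function with traces in `M_S` has traces in `M_R`. -/
lemma pull_mem_M (hI : R.IsAffineImage S A) {c : NNReal} (Hb : (bdry R.K).map A ≤ c • bdry S.K)
    {γ : NNReal} (hγ : LipschitzWith γ A.symm)
    {μ : Lp ℝ 2 (bdry S.K)} (hμ : μ ∈ S.M) : pull Hb μ ∈ R.M := by
  intro F hF
  have hAF : A '' F ∈ S.faces := by rw [hI.faces_eq]; exact Set.mem_image_of_mem _ hF
  obtain ⟨m, hm, hmx⟩ := hI.M_to F hF _ (hμ _ hAF)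
  have h1 : toL2 ((surf d).restrict F) (pull Hb μ) = m := by
    rw [← toL2_coeFn m]
    refine toL2_congr ?_
    have h2 : ∀ᵐ x ∂((surf d).restrict F), pull Hb μ x = μ (A x) :=
      R.ae_face_of_ae_bdry hF (coeFn_toL2 ((Lp.memLp μ).comp_of_map_le Hb))
    have h3 := ae_comp_of_map_le (map_restrict_le hγ (d - 1) F)
      (coeFn_toL2 (S.memLp_face hAF μ))
    filter_upwards [h2, hmx, h3] with x e2 e3 e4
    rw [e2, ← e3]
    exact e4.symm
  rw [h1]
  exact hm

section transport

variable {δ : ℝ} {G : Triple S.K} {u : Triple R.K}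

lemma inner_field_gradient (hint : ∀ f : E d → ℝ, ∫ x in S.K, f x = δ * ∫ x in R.K, f (A x))
    (hG : ∀ᵐ x ∂(vol R.K), field G (A x) = A.linear (field u x))
    {φ : E d → ℝ} (hφ : ContDiff ℝ ∞ φ) :
    ⟪field G, toL2 (vol S.K) (gradient φ)⟫ =
      δ * ⟪field u, toL2 (vol R.K) (gradient (φ ∘ A))⟫ := by
  rw [inner_toL2_right _ (S.isElement.memLp_vol (continuous_gradient hφ)),
    inner_toL2_right _ (R.isElement.memLp_vol
      (continuous_gradient (hφ.comp (contDiff_affineEquiv A)))), hint]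
  congr 1
  refine integral_congr_ae ?_
  filter_upwards [hG] with x hx
  rw [hx, inner_gradient_comp hφ]

lemma inner_toL2_comp (hint : ∀ f : E d → ℝ, ∫ x in S.K, f x = δ * ∫ x in R.K, f (A x))
    {c : NNReal} (Hv : (vol R.K).map A ≤ c • vol S.K) (f : Lp ℝ 2 (vol S.K))
    {φ : E d → ℝ} (hφ : Continuous φ) :
    ⟪f, toL2 (vol S.K) φ⟫ = δ * ⟪pull Hv f, toL2 (vol R.K) (φ ∘ A)⟫ := by
  rw [inner_toL2_right _ (S.isElement.memLp_vol hφ),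
    inner_toL2_right _ (R.isElement.memLp_vol (hφ.comp (contDiff_affineEquiv A).continuous)), hint]
  congr 1
  refine integral_congr_ae ?_
  filter_upwards [coeFn_toL2 ((Lp.memLp f).comp_of_map_le Hv)] with x hx
  rw [pull_apply, hx, Function.comp_apply]

/-- The Piola transformation preserves the divergence. -/
lemma pull_dv (hI : R.IsAffineImage S A) (hd : 1 ≤ d) (hδ : 0 < δ)
    (hint : ∀ f : E d → ℝ, ∫ x in S.K, f x = δ * ∫ x in R.K, f (A x))
    {c : NNReal} (Hv : (vol R.K).map A ≤ c • vol S.K) (hGV : G ∈ S.V) (huV : u ∈ R.V)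
    (hG : ∀ᵐ x ∂(vol R.K), field G (A x) = A.linear (field u x)) :
    pull Hv (dv G) = dv u := by
  rw [← sub_eq_zero]
  refine R.isElement.eq_zero_of_inner_smooth_interior hd _ fun ψ hψ hz => ?_
  -- Test functions that vanish on the boundary avoid the normal traces, whose transformation is
  -- derived from this result.
  have hψ' : ContDiff ℝ ∞ (ψ ∘ A.symm) := hψ.comp (contDiff_affineEquiv A.symm)
  have hcomp : (ψ ∘ A.symm) ∘ A = ψ := by funext x; simp
  have e1 : ⟪field G, toL2 (vol S.K) (gradient (ψ ∘ A.symm))⟫ +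
      ⟪dv G, toL2 (vol S.K) (ψ ∘ A.symm)⟫ = ⟪ntr G, toL2 (bdry S.K) (ψ ∘ A.symm)⟫ :=
    S.V_le hGV _ hψ'
  have e2 : ⟪field u, toL2 (vol R.K) (gradient ψ)⟫ + ⟪dv u, toL2 (vol R.K) ψ⟫ =
      ⟪ntr u, toL2 (bdry R.K) ψ⟫ := R.V_le huV _ hψ
  have z1 : toL2 (bdry R.K) ψ = 0 := by
    refine toL2_eq_zero ?_
    filter_upwards [ae_restrict_mem R.isElement.isCompact_frontier.measurableSet] with x hx
      using hz x hx
  have z2 : toL2 (bdry S.K) (ψ ∘ A.symm) = 0 := by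
    refine toL2_eq_zero ?_
    filter_upwards [ae_restrict_mem S.isElement.isCompact_frontier.measurableSet] with x hx
    refine hz _ ?_
    rw [← hI.image_symm_frontier]
    exact Set.mem_image_of_mem _ hx
  rw [z1, inner_zero_right] at e2
  rw [z2, inner_zero_right, inner_field_gradient hint hG hψ', inner_toL2_comp hint Hv _ hψ'.continuous,
    hcomp, ← mul_add] at e1
  have e3 := (mul_eq_zero.1 e1).resolve_left hδ.ne'
  rw [inner_sub_left]
  linarith

/-- The Piola transformation preserves the normal fluxes, up to the Jacobian. -/
lemma inner_ntr (hI : R.IsAffineImage S A) (hd : 1 ≤ d) (hδ : 0 < δ)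
    (hint : ∀ f : E d → ℝ, ∫ x in S.K, f x = δ * ∫ x in R.K, f (A x))
    {c : NNReal} (Hv : (vol R.K).map A ≤ c • vol S.K)
    {c' : NNReal} (Hb : (bdry R.K).map A ≤ c' • bdry S.K) (hGV : G ∈ S.V) (huV : u ∈ R.V)
    (hG : ∀ᵐ x ∂(vol R.K), field G (A x) = A.linear (field u x)) (η : Lp ℝ 2 (bdry S.K)) :
    ⟪η, ntr G⟫ = δ * ⟪pull Hb η, ntr u⟫ := by
  have := S.isElement.isFiniteMeasure_bdry hd
  -- The normal trace is identified weakly through Green's formula on both elements, so neither the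
  -- normals nor a surface Jacobian appear.
  have h1 : ntr G - δ • (pull Hb).adjoint (ntr u) = 0 := by
    refine eq_zero_of_inner_smooth _ fun φ hφ => ?_
    have e1 : ⟪field G, toL2 (vol S.K) (gradient φ)⟫ + ⟪dv G, toL2 (vol S.K) φ⟫ =
        ⟪ntr G, toL2 (bdry S.K) φ⟫ := S.V_le hGV _ hφ
    have hφ' : ContDiff ℝ ∞ (φ ∘ A) := hφ.comp (contDiff_affineEquiv A)
    have e2 : ⟪field u, toL2 (vol R.K) (gradient (φ ∘ A))⟫ + ⟪dv u, toL2 (vol R.K) (φ ∘ A)⟫ =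
        ⟪ntr u, toL2 (bdry R.K) (φ ∘ A)⟫ := R.V_le huV _ hφ'
    rw [inner_field_gradient hint hG hφ, inner_toL2_comp hint Hv _ hφ.continuous,
      hI.pull_dv hd hδ hint Hv hGV huV hG, ← mul_add, e2] at e1
    rw [inner_sub_left, real_inner_smul_left, ContinuousLinearMap.adjoint_inner_left,
      pull_toL2 Hb (S.isElement.memLp_bdry hd hφ.continuous), ← e1]
    exact sub_self _
  rw [sub_eq_zero.1 h1, real_inner_smul_right, ContinuousLinearMap.adjoint_inner_right]

end transport

lemma norm_sq_le_pull {μ ν : Measure (E d)} {c c' : NNReal} (H : μ.map A ≤ c • ν)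
    (H' : ν.map A.symm ≤ c' • μ) (η : Lp ℝ 2 ν) : ‖η‖ ^ 2 ≤ c' * ‖pull H η‖ ^ 2 := by
  have h1 := norm_toL2_comp_sq_le H' ((Lp.memLp η).comp_of_map_le H)
  simpa [toL2_coeFn, ← pull_apply H η] using h1

lemma norm_toL2_sq_le_comp {G : Type*} [NormedAddCommGroup G] [InnerProductSpace ℝ G]
    {μ ν : Measure (E d)} {c' : NNReal} (H' : ν.map A.symm ≤ c' • μ) {f : E d → G}
    (hf : MemLp (fun x => f (A x)) 2 μ) :
    ‖toL2 ν f‖ ^ 2 ≤ c' * ‖toL2 μ (fun x => f (A x))‖ ^ 2 := by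
  simpa using norm_toL2_comp_sq_le H' hf

end IsAffineImage

end LocalSpaces

/-! ### Estimates transported from the reference element -/

namespace LocalSpaces

variable {d : ℕ} {R S : LocalSpaces d} {A : E d ≃ᵃ[ℝ] E d}

/-- The discrete gradient equation on a single element, for one component. -/
def LocalGradientEq (S : LocalSpaces d) (v : Triple S.K) (u : MvPolynomial (Fin d) ℝ)
    (μ : Lp ℝ 2 (bdry S.K)) : Prop :=
  ∀ G ∈ S.V, ⟪field v, field G⟫ - ⟪res S.K u, dv G⟫ + ⟪μ, ntr G⟫ = 0

namespace IsAffineImage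

/-- The pull-back to the reference element of the field, composed with the transpose of the linear
part. -/
noncomputable def pullField (R : LocalSpaces d) (A : E d ≃ᵃ[ℝ] E d) {K : Set (E d)}
    (f : Lp (E d) 2 (vol K)) : Lp (E d) 2 (vol R.K) :=
  toL2 (vol R.K) (fun x => (lin A).adjoint (f (A x)))

lemma memLp_pullField {K : Set (E d)} {c : NNReal} (Hv : (vol R.K).map A ≤ c • vol K)
    (f : Lp (E d) 2 (vol K)) :
    MemLp (fun x => (lin A).adjoint (f (A x))) 2 (vol R.K) :=
  (lin A).adjoint.comp_memLp' ((Lp.memLp f).comp_of_map_le Hv)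

lemma norm_lin_le {β : NNReal} (hβ : ∀ v, ‖A.linear v‖ ≤ β * ‖v‖) : ‖lin A‖ ≤ β :=
  ContinuousLinearMap.opNorm_le_bound _ β.coe_nonneg hβ

lemma norm_adjoint_lin_le {β : NNReal} (hβ : ∀ v, ‖A.linear v‖ ≤ β * ‖v‖) (v : E d) :
    ‖(lin A).adjoint v‖ ≤ β * ‖v‖ := by
  refine ((lin A).adjoint.le_opNorm v).trans (mul_le_mul_of_nonneg_right ?_ (norm_nonneg _))
  rw [LinearIsometryEquiv.norm_map]
  exact norm_lin_le hβ

lemma norm_pullField_sq_le {β c : NNReal} (hβ : ∀ v, ‖A.linear v‖ ≤ β * ‖v‖)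
    {K : Set (E d)} (Hv : (vol R.K).map A ≤ c • vol K) (f : Lp (E d) 2 (vol K)) :
    ‖pullField R A f‖ ^ 2 ≤ β ^ 2 * (c * ‖f‖ ^ 2) := by
  have h1 := norm_toL2_comp_sq_le Hv (Lp.memLp f)
  rw [toL2_coeFn] at h1
  refine (norm_toL2_sq_le_of_norm_le (memLp_pullField Hv f) ((Lp.memLp f).comp_of_map_le Hv)
    (Filter.Eventually.of_forall fun x => norm_adjoint_lin_le hβ _)).trans ?_
  gcongr

/-- The gradient on the image is controlled by the gradient on the reference element. -/
lemma norm_grad_sq_le {γ c : NNReal} (hγ : ∀ v, ‖A.symm.linear v‖ ≤ γ * ‖v‖)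
    (Hv' : (vol S.K).map A.symm ≤ c • vol R.K) {u q : MvPolynomial (Fin d) ℝ}
    (hq : ∀ x, fn u (A x) = fn q x) :
    ‖grad S.K u‖ ^ 2 ≤ c * (γ ^ 2 * ‖grad R.K q‖ ^ 2) := by
  have hu := continuous_gradient (contDiff_fn u)
  have hm : MemLp (fun x => gradient (fn u) (A x)) 2 (vol R.K) :=
    R.isElement.memLp_vol (hu.comp (contDiff_affineEquiv A).continuous)
  refine (norm_toL2_sq_le_comp Hv' hm).trans ?_
  gcongr
  refine norm_toL2_sq_le_of_norm_le hm
    (R.isElement.memLp_vol (continuous_gradient (contDiff_fn q)))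
    (Filter.Eventually.of_forall fun x => ?_)
  have h1 : fn q = fn u ∘ A := by funext y; exact (hq y).symm
  -- The chain rule: the gradient transforms with the inverse transpose of the linear part.
  have h2 : gradient (fn u) (A x) = (lin A.symm).adjoint (gradient (fn q) x) := by
    refine ext_inner_left ℝ fun v => ?_
    rw [ContinuousLinearMap.adjoint_inner_right, h1, inner_gradient_comp (contDiff_fn u), lin_apply]
    congr 1
    exact (A.linear.apply_symm_apply v).symm
  rw [h2]
  exact norm_adjoint_lin_le hγ _

/-- The equation for the discrete gradient, on the reference element. -/
lemma pull_equation (hI : R.IsAffineImage S A) (hd : 1 ≤ d) {c c' : NNReal}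
    (Hv : (vol R.K).map A ≤ c • vol S.K) (Hb : (bdry R.K).map A ≤ c' • bdry S.K)
    {v : Triple S.K} {u q : MvPolynomial (Fin d) ℝ} (hq : ∀ x, fn u (A x) = fn q x)
    {μ : Lp ℝ 2 (bdry S.K)} (heq : S.LocalGradientEq v u μ) {G : Triple R.K} (hG : G ∈ R.V) :
    ⟪pullField R A (field v), field G⟫ + ⟪grad R.K q, field G⟫ +
      ⟪pull Hb μ - tr R.K q, ntr G⟫ = 0 := by
  obtain ⟨δ, hδ, hint'⟩ := exists_setIntegral_image A
  have hint : ∀ f : E d → ℝ, ∫ x in S.K, f x = δ * ∫ x in R.K, f (A x) := fun f => by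
    rw [hI.K_eq]; exact hint' _ R.isElement.isCompact.measurableSet f
  obtain ⟨G', hG', hGx⟩ := hI.V_of G hG
  have e0 := heq G' hG'
  have e1 := S.green hG' u
  have h1 : fn u ∘ A = fn q := by funext y; exact hq y
  have e2 : ⟪field G', grad S.K u⟫ = δ * ⟪field G, grad R.K q⟫ := by
    have := inner_field_gradient hint hGx (contDiff_fn u)
    rwa [h1] at this
  have htr : pull Hb (tr S.K u) = tr R.K q := by
    rw [tr, pull_toL2 Hb (S.isElement.memLp_bdry hd (contDiff_fn u).continuous)]
    change toL2 _ (fn u ∘ A) = _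
    rw [h1]; rfl
  have e3 := hI.inner_ntr hd hδ hint Hv Hb hG' hG hGx (μ - tr S.K u)
  rw [map_sub, htr] at e3
  have e4 : ⟪field v, field G'⟫ = δ * ⟪pullField R A (field v), field G⟫ := by
    rw [inner_eq_integral, inner_eq_integral, hint]
    congr 1
    refine integral_congr_ae ?_
    filter_upwards [hGx, coeFn_toL2 (memLp_pullField Hv (field v))] with x hx hx'
    rw [pullField, hx', hx, ContinuousLinearMap.adjoint_inner_left, lin_apply]
  -- Each term of the equation for the Piola image `G'` is `δ` times its counterpart; in the first
  -- one the linear part acting on `G` has been moved to the other factor as a transpose.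
  have e5 : δ * (⟪pullField R A (field v), field G⟫ + ⟪grad R.K q, field G⟫ +
      ⟪pull Hb μ - tr R.K q, ntr G⟫) = 0 := by
    rw [mul_add, mul_add, ← e3, ← e4, real_inner_comm (field G) (grad R.K q), ← e2,
      inner_sub_left, real_inner_comm (ntr G') (tr S.K u), ← e1]
    linarith [real_inner_comm (dv G') (res S.K u)]
  exact (mul_eq_zero.1 e5).resolve_left hδ.ne'

end IsAffineImage

lemma sq_norm_add_le {X : Type*} [SeminormedAddCommGroup X] (x y : X) :
    ‖x + y‖ ^ 2 ≤ 2 * ‖x‖ ^ 2 + 2 * ‖y‖ ^ 2 := by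
  have h1 : ‖x + y‖ ^ 2 ≤ (‖x‖ + ‖y‖) ^ 2 := by gcongr; exact norm_add_le x y
  nlinarith [sq_nonneg (‖x‖ - ‖y‖)]

/-- The estimates before the insertion of the values of the Lipschitz constants. -/
lemma IsAffineImage.estimates (hI : R.IsAffineImage S A) (hd : 1 ≤ d) {C Cp : ℝ}
    (hC : ∀ q ∈ R.W, ∀ μ ∈ R.M, ∀ g : Lp (E d) 2 (vol R.K),
      (∀ G ∈ R.V, ⟪g, field G⟫ + ⟪grad R.K q, field G⟫ + ⟪μ - tr R.K q, ntr G⟫ = 0) →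
        ‖grad R.K q‖ ≤ C * (‖g‖ + ‖R.PMS (tr R.K q - μ)‖) ∧
        ‖tr R.K q - μ‖ ≤ C * (‖g‖ + ‖R.PMS (tr R.K q - μ)‖))
    (hCp : ∀ q ∈ R.W, ∃ c : ℝ,
      ‖toL2 (vol R.K) (fun x => fn q x - c)‖ ≤ Cp * ‖grad R.K q‖ ∧
      ‖toL2 (bdry R.K) (fun x => fn q x - c)‖ ≤ Cp * ‖grad R.K q‖)
    {β γ : NNReal} (hβ : ∀ v, ‖A.linear v‖ ≤ β * ‖v‖) (hγ : ∀ v, ‖A.symm.linear v‖ ≤ γ * ‖v‖)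
    {v : Triple S.K} {u : MvPolynomial (Fin d) ℝ} (hu : u ∈ S.W) {μ : Lp ℝ 2 (bdry S.K)}
    (hμ : μ ∈ S.M) (heq : S.LocalGradientEq v u μ) :
    ∃ D c : ℝ,
      D ≤ 2 * C ^ 2 * (β ^ 2 * (γ ^ d * ‖field v‖ ^ 2) +
        γ ^ (d - 1) * ‖S.PMS (tr S.K u - μ)‖ ^ 2) ∧
      ‖grad S.K u‖ ^ 2 ≤ β ^ d * (γ ^ 2 * D) ∧
      ‖tr S.K u - μ‖ ^ 2 ≤ β ^ (d - 1) * D ∧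
      ‖toL2 (vol S.K) (fun x => fn u x - c)‖ ^ 2 ≤ β ^ d * (Cp ^ 2 * D) ∧
      ‖toL2 (bdry S.K) (fun x => fn u x - c)‖ ^ 2 ≤ β ^ (d - 1) * (Cp ^ 2 * D) := by
  have hLβ := lipschitzWith_of_norm_linear_le A hβ
  have hLγ := lipschitzWith_of_norm_linear_le A.symm hγ
  have Hv := hI.map_vol_le hLγ
  have Hb := hI.map_bdry_le hLγ
  have Hv' := hI.map_symm_vol_le hLβ
  have Hb' := hI.map_symm_bdry_le hLβ
  obtain ⟨q, hqW, hq⟩ := hI.W_to u hu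
  obtain ⟨c, hc1, hc2⟩ := hCp q hqW
  have hfq : (fun x => fn u (A x)) = fn q := funext hq
  have htr : pull Hb (tr S.K u) = tr R.K q := by
    rw [tr, pull_toL2 Hb (S.isElement.memLp_bdry hd (contDiff_fn u).continuous), hfq]; rfl
  have hη : pull Hb (tr S.K u - μ) = tr R.K q - pull Hb μ := by rw [map_sub, htr]
  have := S.isElement.isFiniteMeasure_bdry hd
  have hP : ‖R.PMS (tr R.K q - pull Hb μ)‖ ^ 2 ≤
      (γ ^ (d - 1) : NNReal) * ‖S.PMS (tr S.K u - μ)‖ ^ 2 := by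
    rw [← hη]
    exact norm_starProjection_pull_sq_le Hb
      (fun φ hφ => S.isElement.memLp_bdry hd hφ.continuous) S.MS R.MS hI.MS_of _
  have hg := norm_pullField_sq_le hβ Hv (field v)
  obtain ⟨k1, k2⟩ := hC q hqW _ (hI.pull_mem_M Hb hLγ hμ) _
    fun G hG => hI.pull_equation hd Hv Hb hq heq hG
  push_cast at hP hg
  set x := ‖pullField R A (field v)‖
  set y := ‖R.PMS (tr R.K q - pull Hb μ)‖
  have hxy : (C * (x + y)) ^ 2 ≤ 2 * C ^ 2 * (x ^ 2 + y ^ 2) := by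
    nlinarith [mul_nonneg (sq_nonneg C) (sq_nonneg (x - y))]
  have hgr : ‖grad R.K q‖ ^ 2 ≤ (C * (x + y)) ^ 2 := by gcongr
  -- `D` is the squared bound from stability on the reference element; it dominates both the
  -- gradient and the jump there.
  refine ⟨(C * (x + y)) ^ 2, c, ?_, ?_, ?_, ?_, ?_⟩
  · refine hxy.trans ?_
    gcongr
  · refine (norm_grad_sq_le hγ Hv' hq).trans ?_
    push_cast
    gcongr
  · refine (norm_sq_le_pull Hb Hb' _).trans ?_
    rw [hη]
    push_cast
    gcongr
  · have hm : MemLp (fun x => fn u (A x) - c) 2 (vol R.K) := by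
      simp only [hq]
      exact R.isElement.memLp_vol ((contDiff_fn q).continuous.sub continuous_const)
    refine (norm_toL2_sq_le_comp (f := fun x => fn u x - c) Hv' hm).trans ?_
    simp only [hq]
    push_cast
    gcongr
    calc _ ≤ (Cp * ‖grad R.K q‖) ^ 2 := by gcongr
      _ = Cp ^ 2 * ‖grad R.K q‖ ^ 2 := mul_pow _ _ _
      _ ≤ _ := by gcongr
  · have hm : MemLp (fun x => fn u (A x) - c) 2 (bdry R.K) := by
      simp only [hq]
      exact R.isElement.memLp_bdry hd ((contDiff_fn q).continuous.sub continuous_const)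
    refine (norm_toL2_sq_le_comp (f := fun x => fn u x - c) Hb' hm).trans ?_
    simp only [hq]
    push_cast
    gcongr
    calc _ ≤ (Cp * ‖grad R.K q‖) ^ 2 := by gcongr
      _ = Cp ^ 2 * ‖grad R.K q‖ ^ 2 := mul_pow _ _ _
      _ ≤ _ := by gcongr

/-- The ratio of the measures of the element and of its boundary. -/
lemma IsAffineImage.measure_ratio (hI : R.IsAffineImage S A) (hd : 1 ≤ d)
    {β γ : NNReal} (hβ : ∀ v, ‖A.linear v‖ ≤ β * ‖v‖) (hγ : ∀ v, ‖A.symm.linear v‖ ≤ γ * ‖v‖) :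
    (vol S.K).real Set.univ * (bdry R.K).real Set.univ ≤
      β ^ d * γ ^ (d - 1) * (vol R.K).real Set.univ * (bdry S.K).real Set.univ := by
  have hLβ := lipschitzWith_of_norm_linear_le A hβ
  have hLγ := lipschitzWith_of_norm_linear_le A.symm hγ
  have := S.isElement.isFiniteMeasure_bdry hd
  have := R.isElement.isFiniteMeasure_bdry hd
  have := S.isElement.isFiniteMeasure_vol
  have := R.isElement.isFiniteMeasure_vol
  -- For the constant `1` the norm comparisons become comparisons of volumes and of boundary
  -- measures.
  have h1 := norm_toL2_comp_sq_le (f := fun _ => (1 : ℝ)) (hI.map_symm_vol_le hLβ) (memLp_const 1)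
  have h2 := norm_toL2_comp_sq_le (f := fun _ => (1 : ℝ)) (hI.map_bdry_le hLγ) (memLp_const 1)
  rw [norm_toL2_const_sq, norm_toL2_const_sq] at h1 h2
  push_cast at h1 h2
  rw [one_pow, one_mul, one_mul] at h1 h2
  refine (mul_le_mul h1 h2 measureReal_nonneg (by positivity)).trans_eq ?_
  ring

end LocalSpaces

/-! ### Matching powers of the diameter -/

namespace LocalSpaces

variable {d : ℕ}

/-- The Lipschitz constants `b h` of `A` and `a / h` of `A⁻¹` are inserted, with `d = k + 1`.
Everything reduces to `h ^ k * D ≤ N * h * Q`, where all negative powers of `h` cancel except the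
weight `h⁻¹` of the stabilization. -/
lemma scaled_estimates {k : ℕ} {h a b C Cp X P D gs js zc tc : ℝ} (hh : 0 < h) (ha : 0 ≤ a)
    (hb : 0 ≤ b) (hX : 0 ≤ X) (hP : 0 ≤ P)
    (hD : D ≤ 2 * C ^ 2 * ((b * h) ^ 2 * ((a / h) ^ (k + 1) * X) + (a / h) ^ k * P))
    (hgs : gs ≤ (b * h) ^ (k + 1) * ((a / h) ^ 2 * D)) (hjs : js ≤ (b * h) ^ k * D)
    (hzc : zc ≤ (b * h) ^ (k + 1) * (Cp ^ 2 * D)) (htc : tc ≤ (b * h) ^ k * (Cp ^ 2 * D))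
    {N Q : ℝ} (hN : N = 2 * C ^ 2 * (b ^ 2 * a ^ (k + 1) + a ^ k)) (hQ : Q = X + h⁻¹ * P) :
    gs ≤ b ^ (k + 1) * a ^ 2 * N * Q ∧ js ≤ b ^ k * N * h * Q ∧
      zc ≤ b ^ (k + 1) * Cp ^ 2 * N * h ^ 2 * Q ∧ tc ≤ b ^ k * Cp ^ 2 * N * h * Q := by
  have key : h ^ k * D ≤ N * h * Q := by
    have e1 : h ^ k * D ≤ h ^ k * (2 * C ^ 2 * ((b * h) ^ 2 * ((a / h) ^ (k + 1) * X) +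
        (a / h) ^ k * P)) := by gcongr
    have e2 : h ^ k * (2 * C ^ 2 * ((b * h) ^ 2 * ((a / h) ^ (k + 1) * X) + (a / h) ^ k * P)) =
        2 * C ^ 2 * h * (b ^ 2 * a ^ (k + 1) * X + a ^ k * (h⁻¹ * P)) := by
      rw [div_pow, div_pow, pow_succ h k]
      field_simp
    have e3 : b ^ 2 * a ^ (k + 1) * X + a ^ k * (h⁻¹ * P) ≤
        (b ^ 2 * a ^ (k + 1) + a ^ k) * (X + h⁻¹ * P) := by
      have p1 : 0 ≤ b ^ 2 * a ^ (k + 1) * (h⁻¹ * P) := by positivity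
      have p2 : 0 ≤ a ^ k * X := by positivity
      linarith
    calc h ^ k * D ≤ 2 * C ^ 2 * h * (b ^ 2 * a ^ (k + 1) * X + a ^ k * (h⁻¹ * P)) := e1.trans_eq e2
      _ ≤ 2 * C ^ 2 * h * ((b ^ 2 * a ^ (k + 1) + a ^ k) * (X + h⁻¹ * P)) := by gcongr
      _ = N * h * Q := by rw [hN, hQ]; ring
  refine ⟨?_, ?_, ?_, ?_⟩
  · calc gs ≤ b ^ (k + 1) * a ^ 2 * h⁻¹ * (h ^ k * D) := by
          refine hgs.trans_eq ?_
          rw [mul_pow, pow_succ h k]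
          field_simp
      _ ≤ b ^ (k + 1) * a ^ 2 * h⁻¹ * (N * h * Q) := by gcongr
      _ = _ := by field_simp
  · calc js ≤ b ^ k * (h ^ k * D) := by
          refine hjs.trans_eq ?_
          ring
      _ ≤ b ^ k * (N * h * Q) := by gcongr
      _ = _ := by ring
  · calc zc ≤ b ^ (k + 1) * Cp ^ 2 * h * (h ^ k * D) := by
          refine hzc.trans_eq ?_
          ring
      _ ≤ b ^ (k + 1) * Cp ^ 2 * h * (N * h * Q) := by gcongr
      _ = _ := by ring
  · calc tc ≤ b ^ k * Cp ^ 2 * (h ^ k * D) := by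
          refine htc.trans_eq ?_
          ring
      _ ≤ b ^ k * Cp ^ 2 * (N * h * Q) := by gcongr
      _ = _ := by ring

/-- The seminorm of Poincaré-Friedrichs type is controlled by the approximation by constants. -/
lemma semiPFSq_le (S : LocalSpaces d) (hd : 1 ≤ d) (u : MvPolynomial (Fin d) ℝ) {uh : E d → ℝ}
    (huh : MemLp uh 2 (bdry S.K)) (c : ℝ) {κ : ℝ} (hκ0 : 0 ≤ κ)
    (hκ : (vol S.K).real Set.univ ≤ κ * S.h * (bdry S.K).real Set.univ) :
    S.semiPFSq u uh ≤ 2 * ‖toL2 (vol S.K) (fun x => fn u x - c)‖ ^ 2 +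
      (2 * κ + 1) * S.h * (2 * ‖tr S.K u - toL2 (bdry S.K) uh‖ ^ 2 +
        2 * ‖toL2 (bdry S.K) (fun x => fn u x - c)‖ ^ 2) := by
  have := S.isElement.isFiniteMeasure_bdry hd
  have := S.isElement.isFiniteMeasure_vol
  have hh : 0 ≤ S.h := Metric.diam_nonneg
  have hu := S.isElement.memLp_bdry hd (contDiff_fn u).continuous
  have huc : MemLp (fun x => fn u x - c) 2 (vol S.K) :=
    S.isElement.memLp_vol ((contDiff_fn u).continuous.sub continuous_const)
  have hbc : MemLp (fun x => fn u x - c) 2 (bdry S.K) :=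
    S.isElement.memLp_bdry hd ((contDiff_fn u).continuous.sub continuous_const)
  have e1 := norm_toL2_sub_average_sq huh c
  simp only [semiPFSq]
  set m := ⨍ x, uh x ∂(bdry S.K)
  set e := ‖toL2 (bdry S.K) (fun x => uh x - c)‖ ^ 2
  have e2 : e ≤ 2 * ‖tr S.K u - toL2 (bdry S.K) uh‖ ^ 2 +
      2 * ‖toL2 (bdry S.K) (fun x => fn u x - c)‖ ^ 2 := by
    have h1 : toL2 (bdry S.K) (fun x => uh x - c) =
        (toL2 (bdry S.K) uh - tr S.K u) + toL2 (bdry S.K) (fun x => fn u x - c) := by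
      have hd' : MemLp (fun x => uh x - fn u x) 2 (bdry S.K) := huh.sub hu
      rw [tr, ← toL2_sub huh hu, ← toL2_add hd' hbc]
      congr 1
      funext x
      ring
    simp only [e]
    rw [h1, norm_sub_rev (tr S.K u)]
    exact sq_norm_add_le _ _
  have e3 : ‖toL2 (vol S.K) (fun x => fn u x - m)‖ ^ 2 ≤
      2 * ‖toL2 (vol S.K) (fun x => fn u x - c)‖ ^ 2 +
        2 * ((c - m) ^ 2 * (vol S.K).real Set.univ) := by
    have h1 : toL2 (vol S.K) (fun x => fn u x - m) =
        toL2 (vol S.K) (fun x => fn u x - c) + toL2 (vol S.K) (fun _ => c - m) := by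
      rw [← toL2_add huc (memLp_const _)]
      congr 1
      funext x
      ring
    rw [h1, ← norm_toL2_const_sq]
    exact sq_norm_add_le _ _
  -- The two summands of the Pythagorean identity `e1` bound the distance of `c` from the average
  -- and the oscillation of `û`; `κ` then converts boundary measure into volume.
  have e4 : (c - m) ^ 2 * (bdry S.K).real Set.univ ≤ e := by
    rw [e1]
    exact le_add_of_nonneg_left (by positivity)
  have e5 : ‖toL2 (bdry S.K) (fun x => uh x - m)‖ ^ 2 ≤ e := by
    rw [e1]
    exact le_add_of_nonneg_right (by positivity)
  have e6 : (c - m) ^ 2 * (vol S.K).real Set.univ ≤ κ * S.h * e := by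
    calc (c - m) ^ 2 * (vol S.K).real Set.univ
        ≤ (c - m) ^ 2 * (κ * S.h * (bdry S.K).real Set.univ) := by gcongr
      _ = κ * S.h * ((c - m) ^ 2 * (bdry S.K).real Set.univ) := by ring
      _ ≤ _ := by gcongr
  have e7 : S.h * ‖toL2 (bdry S.K) (fun x => uh x - m)‖ ^ 2 ≤ S.h * e := by gcongr
  have e8 : (2 * κ + 1) * S.h * e ≤ (2 * κ + 1) * S.h * (2 * ‖tr S.K u - toL2 (bdry S.K) uh‖ ^ 2 +
        2 * ‖toL2 (bdry S.K) (fun x => fn u x - c)‖ ^ 2) := by gcongr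
  linarith

/-- The estimates on a single element, with a constant that depends on the reference spaces and
on the shape-regularity only. -/
theorem IsAdmissible.exists_local_estimate {R : LocalSpaces d} (hR : R.IsAdmissible) (hd : 1 ≤ d)
    (σ : ℝ) : ∃ C : ℝ, ∀ (S : LocalSpaces d) (A : E d ≃ᵃ[ℝ] E d), R.IsAffineImage S A →
      (∃ (x : E d) (ρ : ℝ), 0 < ρ ∧ Metric.ball x ρ ⊆ S.K ∧ S.h ≤ σ * ρ) →
      ∀ (v : Triple S.K), ∀ u ∈ S.W, ∀ uh : E d → ℝ, MemLp uh 2 (bdry S.K) →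
        toL2 (bdry S.K) uh ∈ S.M → S.LocalGradientEq v u (toL2 (bdry S.K) uh) →
        S.semiOneSq u uh ≤ C * (‖field v‖ ^ 2 +
          S.h⁻¹ * ‖S.PMS (tr S.K u - toL2 (bdry S.K) uh)‖ ^ 2) ∧
        (S.h ^ 2)⁻¹ * S.semiPFSq u uh ≤ C * (‖field v‖ ^ 2 +
          S.h⁻¹ * ‖S.PMS (tr S.K u - toL2 (bdry S.K) uh)‖ ^ 2) := by
  obtain ⟨k, rfl⟩ : ∃ k, d = k + 1 := ⟨d - 1, by omega⟩
  obtain ⟨C, -, hC⟩ := hR.exists_stability hd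
  have := R.finW
  obtain ⟨Cp, -, hCp⟩ := R.isElement.exists_poincare hd R.W
  obtain ⟨x₀, hx₀⟩ := R.isElement.connected.nonempty
  obtain ⟨ρ₀, hρ₀, hb₀⟩ := Metric.isOpen_iff.1 isOpen_interior x₀ hx₀
  -- `b` comes from a ball in the reference element, giving `‖B‖ ≤ b h_K`; `a` comes from the ball
  -- in `K`, giving `‖B⁻¹‖ ≤ a / h_K`. The absolute value makes `a` nonnegative for every `σ`.
  set b : ℝ := 2 / ρ₀ with hbdef
  set a : ℝ := 2 * R.h * |σ| with hadef
  have hb0 : 0 ≤ b := by positivity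
  have hRh : 0 ≤ R.h := Metric.diam_nonneg
  have ha0 : 0 ≤ a := by positivity
  set N := 2 * C ^ 2 * (b ^ 2 * a ^ (k + 1) + a ^ k) with hN
  have hN0 : 0 ≤ N := by positivity
  -- From `measure_ratio`: the factor `(b h) ^ (k + 1) * (a / h) ^ k` leaves a single power of `h`.
  set κ := b ^ (k + 1) * a ^ k * (vol R.K).real Set.univ / (bdry R.K).real Set.univ with hκdef
  have hκ0 : 0 ≤ κ := by positivity
  set c₁ := b ^ (k + 1) * a ^ 2 * N + b ^ k * N with hc₁
  set c₂ := 2 * (b ^ (k + 1) * Cp ^ 2 * N) +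
    (2 * κ + 1) * (2 * (b ^ k * N) + 2 * (b ^ k * Cp ^ 2 * N)) with hc₂
  refine ⟨max c₁ c₂, ?_⟩
  rintro S A hI ⟨x, ρ, hρ, hball, hσ⟩ v u hu uh huh hM heq
  have hh : 0 < S.h := S.isElement.diam_pos hd
  obtain ⟨β, hβe⟩ : ∃ β : NNReal, (β : ℝ) = b * S.h :=
    ⟨(b * S.h).toNNReal, Real.coe_toNNReal _ (by positivity)⟩
  obtain ⟨γ, hγe⟩ : ∃ γ : NNReal, (γ : ℝ) = a / S.h :=
    ⟨(a / S.h).toNNReal, Real.coe_toNNReal _ (by positivity)⟩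
  have hβ : ∀ w, ‖A.linear w‖ ≤ β * ‖w‖ := fun w => by
    have h1 := norm_linear_le A hρ₀ (hb₀.trans interior_subset)
      (by rw [← hI.K_eq]; exact S.isElement.isCompact.isBounded) w
    rw [← hI.K_eq] at h1
    refine h1.trans_eq ?_
    rw [hβe, hbdef, h]
    ring
  have hγ : ∀ w, ‖A.symm.linear w‖ ≤ γ * ‖w‖ := fun w => by
    have h1 := norm_linear_le A.symm hρ hball
      (by rw [hI.image_symm]; exact R.isElement.isCompact.isBounded) w
    rw [hI.image_symm] at h1
    refine h1.trans (mul_le_mul_of_nonneg_right ?_ (norm_nonneg _))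
    change 2 * R.h / ρ ≤ γ
    rw [hγe, div_le_div_iff₀ hρ hh, hadef, mul_assoc (2 * R.h)]
    refine mul_le_mul_of_nonneg_left (hσ.trans ?_) (by positivity)
    exact mul_le_mul_of_nonneg_right (le_abs_self σ) hρ.le
  obtain ⟨D, c, hD, hgs, hjs, hzc, htc⟩ := hI.estimates hd hC hCp hβ hγ hu hM heq
  simp only [Nat.add_sub_cancel, hβe, hγe] at hD hgs hjs hzc htc
  set X := ‖field v‖ ^ 2
  set P := ‖S.PMS (tr S.K u - toL2 (bdry S.K) uh)‖ ^ 2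
  set Q := X + S.h⁻¹ * P with hQ
  have hQ0 : 0 ≤ Q := by positivity
  obtain ⟨r1, r2, r3, r4⟩ := scaled_estimates hh ha0 hb0 (sq_nonneg _) (sq_nonneg _) hD hgs hjs hzc
    htc hN hQ
  have hbR : 0 < (bdry R.K).real Set.univ := by
    have := R.isElement.isFiniteMeasure_bdry hd
    rw [measureReal_def, ENNReal.toReal_pos_iff]
    refine ⟨pos_iff_ne_zero.2 ?_, measure_lt_top _ _⟩
    simpa using R.isElement.surf_frontier_ne_zero hd
  have hratio : (vol S.K).real Set.univ ≤ κ * S.h * (bdry S.K).real Set.univ := by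
    have h1 := hI.measure_ratio hd hβ hγ
    simp only [Nat.add_sub_cancel, hβe, hγe] at h1
    rw [← le_div_iff₀ hbR] at h1
    refine h1.trans_eq ?_
    rw [hκdef, mul_pow b, div_pow a, pow_succ S.h k]
    field_simp
  have hPF := S.semiPFSq_le hd u huh c hκ0 hratio
  constructor
  · calc S.semiOneSq u uh ≤ b ^ (k + 1) * a ^ 2 * N * Q + S.h⁻¹ * (b ^ k * N * S.h * Q) := by
          rw [semiOneSq]; gcongr
      _ = c₁ * Q := by rw [hc₁]; field_simp
      _ ≤ _ := by gcongr; exact le_max_left _ _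
  · calc (S.h ^ 2)⁻¹ * S.semiPFSq u uh ≤ (S.h ^ 2)⁻¹ * (2 * (b ^ (k + 1) * Cp ^ 2 * N * S.h ^ 2 * Q) +
          (2 * κ + 1) * S.h * (2 * (b ^ k * N * S.h * Q) + 2 * (b ^ k * Cp ^ 2 * N * S.h * Q))) := by
          gcongr
          refine hPF.trans ?_
          gcongr
      _ = c₂ * Q := by rw [hc₂]; field_simp
      _ ≤ _ := by gcongr; exact le_max_right _ _

end LocalSpaces

/-! ### The mesh -/

namespace Mesh

variable {d N : ℕ} (T : Mesh d N)

lemma memLp_bdry (μ : Lp ℝ 2 ((surf d).restrict T.skeleton)) (i : Fin N) :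
    MemLp μ 2 (bdry (T.elem i).K) :=
  (Lp.memLp μ).mono_measure
    (Measure.restrict_mono (Set.subset_iUnion (fun i => frontier (T.elem i).K) i) le_rfl)

lemma onBdry_mem_M {zh : T.TraceFn} (hzh : zh ∈ T.MSpace) (i : Fin N) (j : Fin d) :
    T.onBdry zh i j ∈ (T.elem i).M := by
  intro F hF
  have h1 : toL2 ((surf d).restrict F) (T.onBdry zh i j) = toL2 ((surf d).restrict F) (zh j) :=
    toL2_congr ((T.elem i).ae_face_of_ae_bdry hF (coeFn_toL2 (T.memLp_bdry (zh j) i)))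
  rw [h1]
  exact hzh j i F hF

/-- The test space is a product over elements and rows, so a test function may be supported on a
single row of a single element. -/
lemma DiscreteGradientEq.localGradientEq {T : Mesh d N} {r : T.MatFn} {z : T.VecFn} {zh : T.TraceFn}
    (h : T.DiscreteGradientEq r z zh) (i : Fin N) (j : Fin d) :
    (T.elem i).LocalGradientEq (r i j) (z i j) (T.onBdry zh i j) := by
  intro G hG
  let G' : T.MatFn := Function.update (fun _ _ => 0) i (Function.update (fun _ => 0) j G)
  have hself : G' i j = G := by simp [G']
  have hj : ∀ j', j' ≠ j → G' i j' = 0 := fun j' hj' => by simp [G', hj']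
  have hi : ∀ i', i' ≠ i → ∀ j', G' i' j' = 0 := fun i' hi' j' => by simp [G', hi']
  have hmem : G' ∈ T.GSpace := by
    intro i' j'
    by_cases e : i' = i
    · subst e
      by_cases e' : j' = j
      · subst e'; rw [hself]; exact hG
      · rw [hj j' e']; exact Submodule.zero_mem _
    · rw [hi i' e j']; exact Submodule.zero_mem _
  have h1 := h G' hmem
  have hsum : ∀ f : (i' : Fin N) → Fin d → Triple (T.elem i').K → ℝ, (∀ i' j', f i' j' 0 = 0) →
      ∑ i', ∑ j', f i' j' (G' i' j') = f i j G := by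
    intro f hf
    rw [Finset.sum_eq_single i (fun i' _ e => Finset.sum_eq_zero fun j' _ => by
      rw [hi i' e j', hf]) (by simp), Finset.sum_eq_single j (fun j' _ e => by
      rw [hj j' e, hf]) (by simp), hself]
  rw [hsum (fun i' j' g => ⟪field (r i' j'), field g⟫) (fun _ _ => by simp [field]),
    hsum (fun i' j' g => ⟪res (T.elem i').K (z i' j'), dv g⟫) (fun _ _ => by simp [dv]),
    hsum (fun i' j' g => ⟪T.onBdry zh i' j', ntr g⟫) (fun _ _ => by simp [ntr])] at h1
  exact h1

lemma theta_eq_sum (r : T.MatFn) (z : T.VecFn) (zh : T.TraceFn) :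
    T.theta r z zh = ∑ j, ∑ i, (‖field (r i j)‖ ^ 2 +
      (T.elem i).h⁻¹ * ‖(T.elem i).PMS (T.jump z zh i j)‖ ^ 2) := by
  rw [theta, Finset.sum_comm]
  refine Finset.sum_congr rfl fun i _ => ?_
  rw [Finset.sum_add_distrib, Finset.mul_sum]

lemma inner_PMS_self (S : LocalSpaces d) (η : Lp ℝ 2 (bdry S.K)) :
    ⟪S.PMS η, η⟫ = ‖S.PMS η‖ ^ 2 := by
  rw [← real_inner_self_eq_norm_sq]
  have h1 : S.PMS (S.PMS η) = S.PMS η :=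
    Submodule.starProjection_eq_self_iff.2 (S.MS.starProjection_apply_mem η)
  conv_lhs => rw [← h1]
  exact S.MS.inner_starProjection_left_eq_right _ _

/-- The viscous energy. -/
lemma theta_eq_viscousEnergy {r : T.MatFn} (hr : r ∈ T.GSpace) (z : T.VecFn) (zh : T.TraceFn)
    {ν : ℝ} (hν : 0 < ν) : T.theta r z zh = ν⁻¹ * T.viscousEnergy ν r z zh := by
  rw [theta_eq_sum, Finset.sum_comm, viscousEnergy, stokesForm, Finset.mul_sum]
  refine Finset.sum_congr rfl fun i _ => ?_
  rw [Finset.mul_sum]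
  refine Finset.sum_congr rfl fun j _ => ?_
  -- Green's formula combines the divergence and gradient terms into `⟨u, L n⟩`, which cancels the
  -- terms with `û` and with the flux `-ν L n`; only the two squares remain.
  have e1 := (T.elem i).green (hr i j) (z i j)
  have e2 : ⟪T.onBdry zh i j, ntr (r i j)⟫ =
      ⟪ntr (r i j), tr (T.elem i).K (z i j)⟫ - ⟪ntr (r i j), T.jump z zh i j⟫ := by
    rw [jump, inner_sub_right, real_inner_comm]
    ring
  rw [inner_add_left, inner_neg_left, real_inner_smul_left, real_inner_smul_left,
    real_inner_smul_right, alphaV, real_inner_smul_left, inner_PMS_self, real_inner_self_eq_norm_sq,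
    real_inner_comm (dv (r i j)) (res (T.elem i).K (z i j)), e2, ← e1]
  field_simp
  ring

lemma h_le (i : Fin N) : (T.elem i).h ≤ T.h :=
  le_ciSup (f := fun i => (T.elem i).h) (Set.finite_range _).bddAbove i

end Mesh

end HDG

/-- The constant `C R σ` depends on the reference spaces `R` and on the shape-regularity constant
`σ` only. Every mesh is covered, since each element may serve as its own reference element. -/
theorem theorem5p2 (d : ℕ) (hd : 2 ≤ d) :
    ∃ C : HDG.LocalSpaces d → ℝ → ℝ,
      ∀ (N : ℕ) (T : HDG.Mesh d N) (σ : ℝ) (R : Fin N → HDG.LocalSpaces d)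
        (A : Fin N → (HDG.E d ≃ᵃ[ℝ] HDG.E d)),
        (∀ i, (T.elem i).IsAdmissible) →
        T.ShapeRegular σ →
        (∀ i, (R i).IsAdmissible) →
        (∀ i, (R i).IsAffineImage (T.elem i) (A i)) →
        ∀ C₀ : ℝ, (∀ i, C (R i) σ ≤ C₀) →
        ∀ r ∈ T.GSpace, ∀ z ∈ T.WSpace, ∀ zh ∈ T.MSpace,
          T.DiscreteGradientEq r z zh →
            T.normOneSq z zh ≤ C₀ * T.theta r z zh ∧
            (T.h ^ 2)⁻¹ * T.normPFSq z zh ≤ C₀ * T.theta r z zh ∧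
            ∀ ν : ℝ, 0 < ν → T.theta r z zh = ν⁻¹ * T.viscousEnergy ν r z zh := by
  have hd1 : 1 ≤ d := by omega
  have key : ∀ (R : HDG.LocalSpaces d) (σ : ℝ), ∃ C : ℝ, R.IsAdmissible →
      ∀ (S : HDG.LocalSpaces d) (A : HDG.E d ≃ᵃ[ℝ] HDG.E d), R.IsAffineImage S A →
      (∃ (x : HDG.E d) (ρ : ℝ), 0 < ρ ∧ Metric.ball x ρ ⊆ S.K ∧ S.h ≤ σ * ρ) →
      ∀ (v : HDG.Triple S.K), ∀ u ∈ S.W, ∀ uh : HDG.E d → ℝ, MemLp uh 2 (HDG.bdry S.K) →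
        HDG.toL2 (HDG.bdry S.K) uh ∈ S.M →
        S.LocalGradientEq v u (HDG.toL2 (HDG.bdry S.K) uh) →
        S.semiOneSq u uh ≤ C * (‖HDG.field v‖ ^ 2 +
          S.h⁻¹ * ‖S.PMS (HDG.tr S.K u - HDG.toL2 (HDG.bdry S.K) uh)‖ ^ 2) ∧
        (S.h ^ 2)⁻¹ * S.semiPFSq u uh ≤ C * (‖HDG.field v‖ ^ 2 +
          S.h⁻¹ * ‖S.PMS (HDG.tr S.K u - HDG.toL2 (HDG.bdry S.K) uh)‖ ^ 2) := by
    intro R σ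
    by_cases hR : R.IsAdmissible
    · obtain ⟨C, hC⟩ := hR.exists_local_estimate hd1 σ
      exact ⟨C, fun _ => hC⟩
    -- The constant must be a total function of the reference spaces; its value at inadmissible ones
    -- is irrelevant.
    · exact ⟨0, fun h => absurd h hR⟩
  choose C hC using key
  refine ⟨C, ?_⟩
  intro N T σ R A _ hσ hR hI C₀ hC₀ r hr z hz zh hzh heq
  have hloc : ∀ i j, _ := fun i j => hC (R i) σ (hR i) (T.elem i) (A i) (hI i) (hσ i) (r i j) (z i j)
    (hz i j) (zh j) (T.memLp_bdry (zh j) i) (T.onBdry_mem_M hzh i j) (heq.localGradientEq i j)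
  have hmono : ∀ i j, C (R i) σ * (‖HDG.field (r i j)‖ ^ 2 +
        (T.elem i).h⁻¹ * ‖(T.elem i).PMS (T.jump z zh i j)‖ ^ 2) ≤
      C₀ * (‖HDG.field (r i j)‖ ^ 2 +
        (T.elem i).h⁻¹ * ‖(T.elem i).PMS (T.jump z zh i j)‖ ^ 2) := fun i j => by
    have : 0 < (T.elem i).h := (T.elem i).isElement.diam_pos hd1
    exact mul_le_mul_of_nonneg_right (hC₀ i) (by positivity)
  refine ⟨?_, ?_, fun ν hν => T.theta_eq_viscousEnergy hr z zh hν⟩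
  · rw [T.theta_eq_sum, Finset.mul_sum, HDG.Mesh.normOneSq]
    refine Finset.sum_le_sum fun j _ => ?_
    rw [Finset.mul_sum]
    exact Finset.sum_le_sum fun i _ => (hloc i j).1.trans (hmono i j)
  · rw [T.theta_eq_sum, Finset.mul_sum, HDG.Mesh.normPFSq, Finset.mul_sum]
    refine Finset.sum_le_sum fun j _ => ?_
    rw [Finset.mul_sum, Finset.mul_sum]
    refine Finset.sum_le_sum fun i _ => ?_
    have hpos : 0 < (T.elem i).h := (T.elem i).isElement.diam_pos hd1
    have hle := T.h_le i
    have hPF : 0 ≤ (T.elem i).semiPFSq (z i j) (zh j) := by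
      simp only [HDG.LocalSpaces.semiPFSq]
      positivity
    -- The local bound carries `h_K⁻²`, and `h⁻² ≤ h_K⁻²`.
    refine le_trans ?_ ((hloc i j).2.trans (hmono i j))
    gcongr
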